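/- Let $d\ge 1$ and let $K\subset\mathbb R^d$ be a convex body (a compact convex set) of volume one; no smoothness of the boundary is assumed. For an integer $n$ let $K_n$ be the convex hull of $n$ independent random points, each uniformly distributed in $K$. Let $\Pi_n$ be the convex hull of $N$ independent uniformly distributed random points in $K$, where $N$ is a Poisson random variable with mean $n$ which is independent of the points (the convex hull of no points is empty). Then there are real numbers $\delta_n$ with $\delta_n\to\frac1{d+1}$ as $n\to\infty$ such that $$\mathbf E\bigl(\mathrm{Vol}(K\setminus\Pi_n)\bigr)=\mathbf E\bigl(\mathrm{Vol}(K\setminus K_n)\bigr)\,\bigl(1+O(n^{-\delta_n})\bigr)\qquad(n\to\infty),$$ where the implied constant may depend on $K$. In particular, this holds if $K$ is smooth, that is, if the boundary of $K$ is twice differentiable with curvature bounded away from $0$ and infinity. -/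

import Mathlib

open MeasureTheory ProbabilityTheory Filter Topology Asymptotics

noncomputable section

namespace RandomPolytope

/-- The uniform probability distribution on the convex body `K`, i.e. Lebesgue measure restricted
to `K` and normalised. -/
def uniformLaw {d : ℕ} (K : ConvexBody (EuclideanSpace ℝ (Fin d))) :
    Measure (EuclideanSpace ℝ (Fin d)) :=
  ProbabilityTheory.cond volume (K : Set (EuclideanSpace ℝ (Fin d)))

/-- The law of a sequence of independent random points, each uniformly distributed in `K`. -/
def pointsLaw {d : ℕ} (K : ConvexBody (EuclideanSpace ℝ (Fin d))) :
    Measure (ℕ → EuclideanSpace ℝ (Fin d)) :=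
  Measure.infinitePi (fun _ : ℕ => uniformLaw K)

/-- The convex hull of the first `n` points of a sequence (empty for `n = 0`). -/
def polytope {d : ℕ} (n : ℕ) (x : ℕ → EuclideanSpace ℝ (Fin d)) :
    Set (EuclideanSpace ℝ (Fin d)) :=
  convexHull ℝ (x '' Set.Iio n)

/-- The volume of the part of `K` that is missed by the convex hull of the first `n` points. -/
def missedVolume {d : ℕ} (K : ConvexBody (EuclideanSpace ℝ (Fin d))) (n : ℕ)
    (x : ℕ → EuclideanSpace ℝ (Fin d)) : ℝ :=
  volume.real ((K : Set (EuclideanSpace ℝ (Fin d))) \ polytope n x)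

/-- `E(Vol(K \ K_n))`, where `K_n` is the convex hull of `n` independent uniform points in `K`. -/
def uniformExpectedMissedVolume {d : ℕ} (K : ConvexBody (EuclideanSpace ℝ (Fin d)))
    (n : ℕ) : ℝ :=
  ∫ x, missedVolume K n x ∂(pointsLaw K)

/-- The law of the Poisson model of intensity `n`: a Poisson random number `N` with mean `n`,
together with an independent sequence of independent uniform points in `K`. -/
def poissonModelLaw {d : ℕ} (K : ConvexBody (EuclideanSpace ℝ (Fin d))) (n : ℕ) :
    Measure (ℕ × (ℕ → EuclideanSpace ℝ (Fin d))) :=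
  (poissonMeasure (n : NNReal)).prod (pointsLaw K)

/-- `E(Vol(K \ Π_n))`, where `Π_n` is the convex hull of `N` independent uniform points in `K`, the
number `N` being Poisson with mean `n` and independent of the points. -/
def poissonExpectedMissedVolume {d : ℕ} (K : ConvexBody (EuclideanSpace ℝ (Fin d)))
    (n : ℕ) : ℝ :=
  ∫ p, missedVolume K p.1 p.2 ∂(poissonModelLaw K n)

/-! The laws are probability measures and the missed volumes are integrable, so that the
expectations above are genuine. -/

lemma isProbabilityMeasure_uniformLaw {d : ℕ} (K : ConvexBody (EuclideanSpace ℝ (Fin d)))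
    (hK : volume (K : Set (EuclideanSpace ℝ (Fin d))) = 1) :
    IsProbabilityMeasure (uniformLaw K) :=
  cond_isProbabilityMeasure_of_finite (by simp [hK]) (by simp [hK])

lemma isProbabilityMeasure_pointsLaw {d : ℕ} (K : ConvexBody (EuclideanSpace ℝ (Fin d)))
    (hK : volume (K : Set (EuclideanSpace ℝ (Fin d))) = 1) :
    IsProbabilityMeasure (pointsLaw K) := by
  have := isProbabilityMeasure_uniformLaw K hK
  unfold pointsLaw
  infer_instance

lemma isClosed_polytope {d : ℕ} (n : ℕ) :
    IsClosed {p : (ℕ → EuclideanSpace ℝ (Fin d)) × EuclideanSpace ℝ (Fin d) |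
      p.2 ∈ polytope n p.1} := by
  have hcl : IsClosed {q : ((ℕ → EuclideanSpace ℝ (Fin d)) × EuclideanSpace ℝ (Fin d)) ×
      stdSimplex ℝ (Fin n) | ∑ i : Fin n, q.2.1 i • q.1.1 i = q.1.2} := by
    refine isClosed_eq ?_ (by fun_prop)
    refine continuous_finsetSum _ fun i _ => ?_
    have h1 : Continuous fun q : ((ℕ → EuclideanSpace ℝ (Fin d)) × EuclideanSpace ℝ (Fin d)) ×
        stdSimplex ℝ (Fin n) => q.2.1 i :=
      (continuous_apply i).comp (continuous_subtype_val.comp continuous_snd)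
    have h2 : Continuous fun q : ((ℕ → EuclideanSpace ℝ (Fin d)) × EuclideanSpace ℝ (Fin d)) ×
        stdSimplex ℝ (Fin n) => q.1.1 (i : ℕ) := by fun_prop
    exact h1.smul h2
  have := isClosedMap_fst_of_compactSpace _ hcl
  convert this using 1
  ext ⟨x, y⟩
  have hr : x '' Set.Iio n = Set.range (fun i : Fin n => x i) := by
    ext z
    constructor
    · rintro ⟨i, hi, rfl⟩
      exact ⟨⟨i, hi⟩, rfl⟩
    · rintro ⟨i, rfl⟩
      exact ⟨i, i.2, rfl⟩
  simp only [polytope, hr, Set.mem_ofPred_eq, Set.mem_image, Prod.exists, Subtype.exists]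
  rw [convexHull_range_eq_exists_affineCombination]
  constructor
  · rintro ⟨s, w, hw0, hw1, hy⟩
    classical
    refine ⟨x, y, fun i => if i ∈ s then w i else 0, ⟨fun i => ?_, ?_⟩, ?_, rfl⟩
    · dsimp only
      split_ifs with h
      · exact hw0 i h
      · exact le_rfl
    · simpa using hw1
    · rw [Finset.affineCombination_eq_linear_combination _ _ _ hw1] at hy
      change ∑ i : Fin n, (if i ∈ s then w i else 0) • x i = y
      simpa [ite_smul] using hy
  · rintro ⟨x', y', w, hw, h, heq⟩
    obtain ⟨rfl, rfl⟩ := Prod.mk.inj heq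
    refine ⟨Finset.univ, w, fun i _ => hw.1 i, hw.2, ?_⟩
    rw [Finset.affineCombination_eq_linear_combination _ _ _ hw.2]
    exact h

lemma measurable_missedVolume {d : ℕ} (K : ConvexBody (EuclideanSpace ℝ (Fin d))) (n : ℕ) :
    Measurable (missedVolume K n) := by
  have hs : MeasurableSet {p : (ℕ → EuclideanSpace ℝ (Fin d)) × EuclideanSpace ℝ (Fin d) |
      p.2 ∈ (K : Set (EuclideanSpace ℝ (Fin d))) \ polytope n p.1} :=
    (measurable_snd K.isClosed.measurableSet).diff (isClosed_polytope n).measurableSet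
  exact (measurable_measure_prodMk_left (ν := volume) hs).ennreal_toReal

lemma missedVolume_mem_Icc {d : ℕ} (K : ConvexBody (EuclideanSpace ℝ (Fin d)))
    (hK : volume (K : Set (EuclideanSpace ℝ (Fin d))) = 1) (n : ℕ)
    (x : ℕ → EuclideanSpace ℝ (Fin d)) : missedVolume K n x ∈ Set.Icc (0 : ℝ) 1 := by
  refine ⟨measureReal_nonneg, ?_⟩
  have h : volume.real (K : Set (EuclideanSpace ℝ (Fin d))) = 1 := by simp [Measure.real, hK]
  rw [← h]
  exact measureReal_mono Set.sdiff_subset (by simp [hK])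

lemma integrable_missedVolume {d : ℕ} (K : ConvexBody (EuclideanSpace ℝ (Fin d)))
    (hK : volume (K : Set (EuclideanSpace ℝ (Fin d))) = 1) (n : ℕ) :
    Integrable (missedVolume K n) (pointsLaw K) := by
  have := isProbabilityMeasure_pointsLaw K hK
  exact Integrable.of_mem_Icc 0 1 (measurable_missedVolume K n).aemeasurable
    (ae_of_all _ fun x => missedVolume_mem_Icc K hK n x)

lemma integrable_missedVolume_poisson {d : ℕ} (K : ConvexBody (EuclideanSpace ℝ (Fin d)))
    (hK : volume (K : Set (EuclideanSpace ℝ (Fin d))) = 1) (n : ℕ) :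
    Integrable (fun p : ℕ × (ℕ → EuclideanSpace ℝ (Fin d)) => missedVolume K p.1 p.2)
      (poissonModelLaw K n) := by
  have := isProbabilityMeasure_pointsLaw K hK
  have : IsProbabilityMeasure (poissonModelLaw K n) := by
    unfold poissonModelLaw
    infer_instance
  exact Integrable.of_mem_Icc 0 1
    (measurable_from_prod_countable_right fun k => measurable_missedVolume K k).aemeasurable
    (ae_of_all _ fun p => missedVolume_mem_Icc K hK p.1 p.2)

end RandomPolytope

end

/-!
Write `e n` for the expected volume missed by the hull of `n` points. The Poisson expectation is
the mean of `e N` for a Poisson number `N` of mean `n`, and `N` deviates from `n` by `√n` in the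
mean. So it suffices that `e` is Lipschitz on the relative scale, `|e k - e n| ≤ D |k - n| / n * e n`
for `k ≥ n / 2`, and that `e` does not decay exponentially, which makes the event `N < n / 2`
negligible. The result is a relative error of order `n ^ (-1 / 2)`, and `1 / 2 ≥ 1 / (d + 1)`.

The Lipschitz property has two sources.

* `mul_sub_uniformExpectedMissedVolume_le`: by Carathéodory's theorem a point of the hull of `k + m`
  points is lost for at most `d + 1` of the `k + m` possible deletions of a single point, and if it
  is lost when one of the last `m` points is deleted, then it is not in the hull of the first `k`.
  By exchangeability, `m (e (k + m - 1) - e (k + m)) ≤ (d + 1) e k`.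
* `exists_expectedMiss_half_le` (doubling): `e (n / 2) ≤ A * e n`. With `k` about half of `k + m`,
  this turns the previous estimate into `e (n - 1) - e n ≤ D / n * e n`.

For doubling, let `0` be an interior point of `K`, let `ρ` be the gauge of `K`, and consider the
bijection `S z = z / (1 + a - a ρ(z))` of `K` (`pullIn`). Since the denominator is a concave function
of `z`, the image under `S` of the hull of some points is covered by the hull of `0` and the images
of the points (`pullIn_mem_convexHull`). Close to the boundary, `S` stretches the radial direction
by the factor `1 + a`, so it thins out the uniform distribution: for `a = 7` the image of the uniform
law has density at most `1 / 4` outside a dilate `L` of `K` (`map_pullIn`, `map_pullIn_restrict_le`),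
while it is at least `1 / 8` everywhere. Hence the hull of `n` points misses at least `1 / 8` of what
is missed by the hull of `L` and a binomial number of points with mean `n / 4`
(`binomialAverage_le_expectedMiss`), which is at most `n / 2` with probability at least one half.
Finally, adding `L` to the hull makes only an exponentially small difference
(`expectedMiss_le_expectedMiss_union_add`, `exists_net_subset_convexHull`), and this is dominated
by `e n`, because all points may lie in a dilate of `K` of measure close to `1`
(`geometric_le_expectedMiss`).

Expectations over the points are written as iterated lower integrals (`expectedMiss`), for which all
of these comparisons hold without any discussion of measurability.
-/

namespace RandomPolytope

open scoped ENNReal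

/-! ### Binomial averages -/

/-- `binomialAverage p q n u` is the mean of `u` under the binomial law with `n` trials, success
probability `q` and failure probability `p`. -/
noncomputable def binomialAverage (p q : ℝ≥0∞) : ℕ → (ℕ → ℝ≥0∞) → ℝ≥0∞
  | 0, u => u 0
  | n + 1, u => p * binomialAverage p q n u + q * binomialAverage p q n fun k => u (k + 1)

lemma binomialAverage_lintegral_le {Ω : Type*} [MeasurableSpace Ω] (μ : Measure Ω)
    {p q : ℝ≥0∞} (hp : p ≠ ∞) (hq : q ≠ ∞) (n : ℕ) (u : Ω → ℕ → ℝ≥0∞) :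
    binomialAverage p q n (fun k => ∫⁻ x, u x k ∂μ) ≤ ∫⁻ x, binomialAverage p q n (u x) ∂μ := by
  induction n generalizing u with
  | zero => exact le_rfl
  | succ n ih =>
    simp only [binomialAverage]
    refine le_trans ?_ (le_lintegral_add _ _)
    rw [lintegral_const_mul' _ _ hp, lintegral_const_mul' _ _ hq]
    gcongr
    · exact ih u
    · exact ih fun x k => u x (k + 1)

/-- The mean of an affine function under the binomial law bounds the mean of a function that lies
above it. -/
lemma le_toReal_binomialAverage {β : ℝ} (h0 : 0 ≤ β) (h1 : β ≤ 1) (n : ℕ) {u : ℕ → ℝ≥0∞}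
    (hu : ∀ k, u k ≤ 1) {a b : ℝ} (h : ∀ k, a - b * k ≤ (u k).toReal) :
    a - b * (n * β) ≤
        (binomialAverage (1 - ENNReal.ofReal β) (ENNReal.ofReal β) n u).toReal ∧
      binomialAverage (1 - ENNReal.ofReal β) (ENNReal.ofReal β) n u ≤ 1 := by
  have hβ : ENNReal.ofReal β ≤ 1 := by simpa using h1
  induction n generalizing u a with
  | zero => exact ⟨by simpa [binomialAverage] using h 0, hu 0⟩
  | succ n ih =>
    obtain ⟨i1, i2⟩ := ih hu h
    obtain ⟨j1, j2⟩ := ih (u := fun k => u (k + 1)) (a := a - b) (fun k => hu _) (fun k => by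
      have := h (k + 1)
      push_cast at this
      linarith)
    have hne : ∀ {x : ℝ≥0∞}, x ≤ 1 → x ≠ ∞ := fun hx => ne_top_of_le_ne_top ENNReal.one_ne_top hx
    constructor
    · simp only [binomialAverage]
      rw [ENNReal.toReal_add (ENNReal.mul_ne_top (by simp) (hne i2))
        (ENNReal.mul_ne_top (by simp) (hne j2)), ENNReal.toReal_mul, ENNReal.toReal_mul,
        ENNReal.toReal_sub_of_le hβ (by simp), ENNReal.toReal_ofReal h0, ENNReal.toReal_one]
      have e1 := mul_le_mul_of_nonneg_left i1 (sub_nonneg.2 h1)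
      have e2 := mul_le_mul_of_nonneg_left j1 h0
      push_cast
      nlinarith
    · simp only [binomialAverage]
      calc _ ≤ (1 - ENNReal.ofReal β) * 1 + ENNReal.ofReal β * 1 := by gcongr
        _ = 1 := by rw [mul_one, mul_one, tsub_add_cancel_of_le hβ]

/-- By Markov's inequality, at least half of the mass of the binomial law with `n` trials and
success probability `1 / 4` lies on `k ≤ n / 2`. -/
lemma half_le_toReal_binomialAverage (n : ℕ) {u : ℕ → ℝ≥0∞} (hu : ∀ k, u k ≤ 1)
    (hanti : Antitone u) :
    (u (n / 2)).toReal / 2 ≤ (binomialAverage (1 - ENNReal.ofReal (1 / 4))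
      (ENNReal.ofReal (1 / 4)) n u).toReal := by
  set m := n / 2 with hm
  have hmn : (n : ℝ) ≤ 2 * ((m : ℝ) + 1) := by
    have : n ≤ 2 * (m + 1) := by omega
    exact_mod_cast this
  have hpos : (0 : ℝ) < (m : ℝ) + 1 := by positivity
  set s := (u m).toReal with hs
  have hs0 : 0 ≤ s := ENNReal.toReal_nonneg
  have key := (le_toReal_binomialAverage (β := 1 / 4) (by norm_num) (by norm_num) n hu
    (a := s) (b := s / (m + 1)) (fun k => by
      rcases le_or_gt k m with hk | hk
      · have : s ≤ (u k).toReal :=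
          ENNReal.toReal_mono (ne_top_of_le_ne_top ENNReal.one_ne_top (hu k)) (hanti hk)
        have : 0 ≤ s / (m + 1) * k := by positivity
        linarith
      · have hk' : (m : ℝ) + 1 ≤ k := by exact_mod_cast hk
        have : s ≤ s / (m + 1) * k := by
          rw [div_mul_eq_mul_div, le_div_iff₀ hpos]
          exact mul_le_mul_of_nonneg_left hk' hs0
        have : 0 ≤ (u k).toReal := ENNReal.toReal_nonneg
        linarith)).1
  have : s / (m + 1) * (n * (1 / 4)) ≤ s / 2 := by
    rw [div_mul_eq_mul_div, div_le_iff₀ hpos]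
    nlinarith
  linarith

/-- A point of law `ν` is no more useful than a point of law `μ` that is replaced by a useless
point with probability `1 - β`, if `ν ≤ β μ` outside the set `L` of useless points. -/
lemma mixture_le_lintegral {Ω : Type*} [MeasurableSpace Ω]
    {μ ν : Measure Ω} [IsProbabilityMeasure μ] [IsProbabilityMeasure ν]
    {L : Set Ω} (hL : MeasurableSet L) {β : ℝ≥0∞} (hβ : β ≤ 1)
    (hν : ν.restrict Lᶜ ≤ β • μ.restrict Lᶜ) {G : Ω → ℝ≥0∞} {c : ℝ≥0∞} (hG : ∀ x, G x ≤ c)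
    (hGL : ∀ x ∈ L, G x = c) : (1 - β) * c + β * ∫⁻ x, G x ∂μ ≤ ∫⁻ x, G x ∂ν := by
  have hβt : β ≠ ∞ := ne_top_of_le_ne_top ENNReal.one_ne_top hβ
  have hconst : ∀ σ : Measure Ω, ∫⁻ x in L, G x ∂σ = c * σ L := fun σ => by
    rw [setLIntegral_congr_fun hL hGL, setLIntegral_const]
  set κ := β • μ.restrict Lᶜ - ν.restrict Lᶜ with hκ
  have hsum : κ + ν.restrict Lᶜ = β • μ.restrict Lᶜ := Measure.sub_add_cancel_of_le hν
  have htot : κ Set.univ + ν Lᶜ = β * μ Lᶜ := by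
    have := congrArg (fun m : Measure Ω => m Set.univ) hsum
    simpa using this
  -- total masses: the mass `1 - β` and the excess mass of `β μ` make up the mass of `ν` on `L`
  have hmass : (1 - β) + β * μ L + κ Set.univ = ν L := by
    have h1 : ν L + ν Lᶜ = 1 := by rw [measure_add_measure_compl hL, measure_univ]
    have h2 : μ L + μ Lᶜ = 1 := by rw [measure_add_measure_compl hL, measure_univ]
    have h3 : (1 - β) + β * μ L + κ Set.univ + ν Lᶜ = ν L + ν Lᶜ := by
      rw [add_assoc _ _ (ν Lᶜ), htot, add_assoc, ← mul_add, h2, mul_one, h1,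
        tsub_add_cancel_of_le hβ]
    exact (ENNReal.add_left_inj (measure_ne_top ν _)).1 h3
  have hβint : β * ∫⁻ x in Lᶜ, G x ∂μ = ∫⁻ x, G x ∂κ + ∫⁻ x in Lᶜ, G x ∂ν := by
    rw [← lintegral_add_measure, hsum, lintegral_smul_measure, smul_eq_mul]
  calc (1 - β) * c + β * ∫⁻ x, G x ∂μ
      = (1 - β) * c + (β * (c * μ L) + (∫⁻ x, G x ∂κ + ∫⁻ x in Lᶜ, G x ∂ν)) := by
        rw [← lintegral_add_compl G hL, hconst, mul_add, hβint]
    _ ≤ (1 - β) * c + (β * (c * μ L) + (c * κ Set.univ + ∫⁻ x in Lᶜ, G x ∂ν)) := by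
        gcongr
        calc ∫⁻ x, G x ∂κ ≤ ∫⁻ _, c ∂κ := lintegral_mono hG
          _ = c * κ Set.univ := lintegral_const c
    _ = c * ν L + ∫⁻ x in Lᶜ, G x ∂ν := by
        rw [← hmass]; ring
    _ = ∫⁻ x, G x ∂ν := by
        conv_rhs => rw [← lintegral_add_compl G hL, hconst]

/-! ### Iterated expectations -/

section Iterated

variable {E : Type*} [AddCommGroup E] [Module ℝ E] [MeasurableSpace E]

/-- The expected `μ`-measure missed by the convex hull of `C` and `n` independent points of law
`σ`, written as an iterated integral over the points, the point drawn first being added to `C`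
first. The set `C` is arbitrary, so that the integrands need not be measurable; the integrals are
then lower integrals. -/
noncomputable def expectedMiss (σ μ : Measure E) : ℕ → Set E → ℝ≥0∞
  | 0, C => μ (convexHull ℝ C)ᶜ
  | n + 1, C => ∫⁻ x, expectedMiss σ μ n (insert x C) ∂σ

lemma expectedMiss_zero (σ μ : Measure E) (C : Set E) :
    expectedMiss σ μ 0 C = μ (convexHull ℝ C)ᶜ := rfl

lemma expectedMiss_succ (σ μ : Measure E) (n : ℕ) (C : Set E) :
    expectedMiss σ μ (n + 1) C = ∫⁻ x, expectedMiss σ μ n (insert x C) ∂σ := rfl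

lemma expectedMiss_anti_of_subset_convexHull (σ μ : Measure E) (n : ℕ) {C D : Set E}
    (h : C ⊆ convexHull ℝ D) : expectedMiss σ μ n D ≤ expectedMiss σ μ n C := by
  induction n generalizing C D with
  | zero =>
    exact measure_mono (Set.compl_subset_compl.2 (convexHull_min h (convex_convexHull ℝ D)))
  | succ n ih =>
    refine lintegral_mono fun x => ih (Set.insert_subset ?_ ?_)
    · exact subset_convexHull ℝ _ (Set.mem_insert x D)
    · exact h.trans (convexHull_mono (Set.subset_insert x D))

lemma expectedMiss_anti (σ μ : Measure E) (n : ℕ) {C D : Set E} (h : C ⊆ D) :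
    expectedMiss σ μ n D ≤ expectedMiss σ μ n C :=
  expectedMiss_anti_of_subset_convexHull σ μ n (h.trans (subset_convexHull ℝ D))

lemma expectedMiss_insert_of_mem (σ μ : Measure E) (n : ℕ) {C : Set E} {x : E}
    (h : x ∈ convexHull ℝ C) : expectedMiss σ μ n (insert x C) = expectedMiss σ μ n C :=
  le_antisymm (expectedMiss_anti σ μ n (Set.subset_insert x C))
    (expectedMiss_anti_of_subset_convexHull σ μ n
      (Set.insert_subset h (subset_convexHull ℝ C)))

lemma expectedMiss_le_one (σ μ : Measure E) [IsProbabilityMeasure σ] [IsProbabilityMeasure μ]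
    (n : ℕ) (C : Set E) : expectedMiss σ μ n C ≤ 1 := by
  induction n generalizing C with
  | zero => exact prob_le_one
  | succ n ih =>
    calc expectedMiss σ μ (n + 1) C ≤ ∫⁻ _, 1 ∂σ := lintegral_mono fun x => ih _
      _ = 1 := by simp

lemma expectedMiss_succ_le (σ μ : Measure E) [IsProbabilityMeasure σ] (n : ℕ) (C : Set E) :
    expectedMiss σ μ (n + 1) C ≤ expectedMiss σ μ n C := by
  calc expectedMiss σ μ (n + 1) C ≤ ∫⁻ _, expectedMiss σ μ n C ∂σ :=
        lintegral_mono fun x => expectedMiss_anti σ μ n (Set.subset_insert x C)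
    _ = expectedMiss σ μ n C := by simp

lemma antitone_expectedMiss (σ μ : Measure E) [IsProbabilityMeasure σ] (C : Set E) :
    Antitone fun n => expectedMiss σ μ n C :=
  antitone_nat_of_succ_le fun n => expectedMiss_succ_le σ μ n C

/-- With all `n` points in the convex set `Q`, everything outside `Q` is missed. -/
lemma mul_pow_le_expectedMiss (μ : Measure E) {Q : Set E} (hQ : Convex ℝ Q)
    (hQm : MeasurableSet Q) (n : ℕ) {C : Set E} (hC : C ⊆ Q) :
    μ Qᶜ * μ Q ^ n ≤ expectedMiss μ μ n C := by
  induction n generalizing C with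
  | zero =>
    simpa [expectedMiss_zero] using measure_mono (μ := μ) (Set.compl_subset_compl.2 (convexHull_min hC hQ))
  | succ n ih =>
    calc μ Qᶜ * μ Q ^ (n + 1) = ∫⁻ _ in Q, μ Qᶜ * μ Q ^ n ∂μ := by
          rw [setLIntegral_const]; ring
      _ ≤ ∫⁻ x in Q, expectedMiss μ μ n (insert x C) ∂μ :=
          setLIntegral_mono' hQm fun x hx => ih (Set.insert_subset hx hC)
      _ ≤ _ := setLIntegral_le_lintegral _ _

/-! ### Replacing the law of the points -/

/-- Replacing points of law `ν` by a binomial number of points of law `μ`. -/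
lemma binomialAverage_le_expectedMiss {μ ν : Measure E} [IsProbabilityMeasure μ]
    [IsProbabilityMeasure ν] {L : Set E} (hL : MeasurableSet L) {β : ℝ≥0∞} (hβ : β ≤ 1)
    (hν : ν.restrict Lᶜ ≤ β • μ.restrict Lᶜ) (n : ℕ) {C : Set E} (hC : L ⊆ C) :
    binomialAverage (1 - β) β n (fun k => expectedMiss μ μ k C) ≤ expectedMiss ν μ n C := by
  have hβt : β ≠ ∞ := ne_top_of_le_ne_top ENNReal.one_ne_top hβ
  induction n generalizing C with
  | zero => exact le_rfl
  | succ n ih =>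
    calc binomialAverage (1 - β) β (n + 1) (fun k => expectedMiss μ μ k C)
        ≤ (1 - β) * expectedMiss ν μ n C + β * ∫⁻ x, expectedMiss ν μ n (insert x C) ∂μ := by
          simp only [binomialAverage, expectedMiss_succ]
          gcongr
          · exact ih hC
          · refine (binomialAverage_lintegral_le μ (by simp) hβt n
              fun x k => expectedMiss μ μ k (insert x C)).trans (lintegral_mono fun x => ?_)
            exact ih (hC.trans (Set.subset_insert x C))
      _ ≤ _ := mixture_le_lintegral hL hβ hν
          (fun x => expectedMiss_anti ν μ n (Set.subset_insert x C))
          fun x hx => expectedMiss_insert_of_mem ν μ n (subset_convexHull ℝ C (hC hx))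

end Iterated

/-! ### A radial map that stretches the layer at the boundary -/

section Radial

variable {E : Type*} [NormedAddCommGroup E] [NormedSpace ℝ E]

/-- Integration in polar coordinates. -/
lemma lintegral_eq_lintegral_sphere [FiniteDimensional ℝ E] [MeasurableSpace E] [BorelSpace E]
    [Nontrivial E] (μ : Measure E) [μ.IsAddHaarMeasure] {g : E → ℝ≥0∞} (hg : Measurable g) :
    ∫⁻ x, g x ∂μ = ∫⁻ θ, ∫⁻ r in Set.Ioi (0 : ℝ),
      ENNReal.ofReal (r ^ (Module.finrank ℝ E - 1)) * g (r • (θ : E)) ∂volume ∂μ.toSphere := by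
  have h1 : ∫⁻ x, g x ∂μ = ∫⁻ x : ({0}ᶜ : Set E), g x ∂(μ.comap (↑)) := by
    rw [lintegral_subtype_comap (measurableSet_singleton _).compl, restrict_compl_singleton]
  have hm : Measurable fun p : Metric.sphere (0 : E) 1 × Set.Ioi (0 : ℝ) =>
      g ((p.2 : ℝ) • (p.1 : E)) := hg.comp (by fun_prop)
  have h2 : ∀ x : ({0}ᶜ : Set E), ((homeomorphUnitSphereProd E x).2 : ℝ) •
      ((homeomorphUnitSphereProd E x).1 : E) = x := fun x =>
    congrArg Subtype.val ((homeomorphUnitSphereProd E).symm_apply_apply x)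
  have h3 := μ.measurePreserving_homeomorphUnitSphereProd.lintegral_comp_emb
    (Homeomorph.measurableEmbedding _) fun p => g ((p.2 : ℝ) • (p.1 : E))
  simp only [h2] at h3
  rw [h1, h3]
  rw [lintegral_prod _ hm.aemeasurable]
  refine lintegral_congr fun θ => ?_
  have hmθ : Measurable fun r : Set.Ioi (0 : ℝ) => g ((r : ℝ) • (θ : E)) := hg.comp (by fun_prop)
  rw [Measure.volumeIoiPow, lintegral_withDensity_eq_lintegral_mul _ (by fun_prop) hmθ]
  exact lintegral_subtype_comap measurableSet_Ioi
    fun r : ℝ => ENNReal.ofReal (r ^ (Module.finrank ℝ E - 1)) * g (r • (θ : E))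

/-- The radial map `z ↦ z / (1 + a - a ρ(z))`, `ρ` the gauge of `K`. It maps `K` onto itself and
multiplies the radial distance to the boundary by about `1 + a` close to the boundary. -/
noncomputable def pullIn (K : Set E) (a : ℝ) (z : E) : E := (1 + a - a * gauge K z)⁻¹ • z

/-- The convex hull of the image of `C` under `pullIn`, together with the centre, covers the image
of the convex hull of `C`: the factor `1 + a - a ρ` is concave. -/
lemma pullIn_mem_convexHull {K : Set E} (hK : Convex ℝ K) (h0 : K ∈ 𝓝 (0 : E)) {a : ℝ}
    (ha : 0 ≤ a) {C : Set E} (hC : C ⊆ K) {y : E} (hy : y ∈ convexHull ℝ C) :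
    pullIn K a y ∈ convexHull ℝ (insert 0 (pullIn K a '' C)) := by
  set V := convexHull ℝ (insert 0 (pullIn K a '' C))
  have hVc : Convex ℝ V := convex_convexHull ℝ _
  have h0V : (0 : E) ∈ V := subset_convexHull ℝ _ (Set.mem_insert _ _)
  have hfac : ∀ y ∈ K, 0 < 1 + a - a * gauge K y := fun y hy => by
    have := mul_le_mul_of_nonneg_left (gauge_le_one_of_mem hy) ha
    linarith
  suffices h : convexHull ℝ C ⊆ {y | y ∈ K ∧ pullIn K a y ∈ V} from (h hy).2
  refine convexHull_min (fun z hz => ⟨hC hz, subset_convexHull ℝ _ (Or.inr ⟨z, hz, rfl⟩)⟩) ?_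
  rintro y ⟨hyK, hyV⟩ z ⟨hzK, hzV⟩ s t hs ht hst
  have hK' : s • y + t • z ∈ K := hK hyK hzK hs ht hst
  refine ⟨hK', ?_⟩
  have hρ : gauge K (s • y + t • z) ≤ s * gauge K y + t * gauge K z := by
    refine (gauge_add_le hK (absorbent_nhds_zero h0) _ _).trans_eq ?_
    rw [gauge_smul_of_nonneg hs, gauge_smul_of_nonneg ht, smul_eq_mul, smul_eq_mul]
  have cy := hfac y hyK
  have cz := hfac z hzK
  have cw := hfac _ hK'
  simp only [pullIn] at hyV hzV ⊢
  set c₁ := 1 + a - a * gauge K y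
  set c₂ := 1 + a - a * gauge K z
  set c := 1 + a - a * gauge K (s • y + t • z) with hc
  have hle : s * c₁ + t * c₂ ≤ c := by
    have h1 := mul_le_mul_of_nonneg_left hρ ha
    have h2 : s * c₁ + t * c₂ = (s + t) * (1 + a) - a * (s * gauge K y + t * gauge K z) := by
      simp only [c₁, c₂]; ring
    rw [h2, hst]
    linarith
  have hle' : s * c₁ / c + t * c₂ / c ≤ 1 := by
    rw [← add_div, div_le_one cw]; exact hle
  -- a convex combination of `0` and the images of `y` and `z`
  have key : c⁻¹ • (s • y + t • z) = (1 - (s * c₁ / c + t * c₂ / c)) • (0 : E) +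
      ((s * c₁ / c) • (c₁⁻¹ • y) + (t * c₂ / c) • (c₂⁻¹ • z)) := by
    simp only [smul_zero, zero_add, smul_add, smul_smul]
    congr 2 <;> field_simp
  rw [key]
  have e1 : 0 ≤ s * c₁ / c := by positivity
  have e2 : 0 ≤ t * c₂ / c := by positivity
  set p := s * c₁ / c
  set q := t * c₂ / c
  have := hVc.sum_mem (t := (Finset.univ : Finset (Fin 3))) (w := ![1 - (p + q), p, q])
    (z := ![0, c₁⁻¹ • y, c₂⁻¹ • z]) (by
      intro i _; fin_cases i <;> simp [e1, e2, hle']) (by simp [Fin.sum_univ_three]; ring)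
      (by intro i _; fin_cases i <;> simp [h0V, hyV, hzV])
  simpa [Fin.sum_univ_three, add_assoc] using this

/-- The change of variables of `pullIn` on one ray, on which the gauge is `r ↦ k r`. -/
lemma lintegral_ray_change {a k : ℝ} (ha : 0 ≤ a) (hk : 0 < k) (f : ℝ → ℝ≥0∞) :
    ∫⁻ r in Set.Ioc 0 k⁻¹, f r =
      ∫⁻ s in Set.Ioc 0 k⁻¹,
        ENNReal.ofReal ((1 + a) / (1 + a * (k * s)) ^ 2) * f ((1 + a) * s / (1 + a * (k * s))) := by
  have hpos : ∀ s ∈ Set.Ioc 0 k⁻¹, 0 < 1 + a * (k * s) := fun s hs => by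
    have := hs.1; positivity
  -- the inverse map is `r ↦ r / (1 + a - a k r)`
  have himg : (fun s => (1 + a) * s / (1 + a * (k * s))) '' Set.Ioc 0 k⁻¹ = Set.Ioc 0 k⁻¹ := by
    ext r
    constructor
    · rintro ⟨s, hs, rfl⟩
      have h1 := hpos s hs
      have h2 := hs.1
      have h3 : k * s ≤ 1 := by
        have := mul_le_mul_of_nonneg_left hs.2 hk.le
        rwa [mul_inv_cancel₀ hk.ne'] at this
      refine ⟨by positivity, ?_⟩
      rw [div_le_iff₀ h1, inv_mul_eq_div, le_div_iff₀ hk]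
      nlinarith
    · intro hr
      have h3 : k * r ≤ 1 := by
        have := mul_le_mul_of_nonneg_left hr.2 hk.le
        rwa [mul_inv_cancel₀ hk.ne'] at this
      have h4 : 0 < 1 + a - a * (k * r) := by nlinarith
      have h5 := hr.1
      have h6 : 1 + a * (k * (r / (1 + a - a * (k * r)))) = (1 + a) / (1 + a - a * (k * r)) := by
        rw [eq_div_iff h4.ne']
        have := div_mul_cancel₀ r h4.ne'
        linear_combination (a * k) * this
      refine ⟨r / (1 + a - a * (k * r)), ⟨by positivity, ?_⟩, ?_⟩
      · rw [div_le_iff₀ h4, inv_mul_eq_div, le_div_iff₀ hk]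
        nlinarith
      · simp only [h6]
        rw [div_eq_iff (by positivity)]
        ring
  have hder : ∀ s ∈ Set.Ioc 0 k⁻¹, HasDerivWithinAt (fun s => (1 + a) * s / (1 + a * (k * s)))
      ((1 + a) / (1 + a * (k * s)) ^ 2) (Set.Ioc 0 k⁻¹) s := fun s hs => by
    have h1 := hpos s hs
    have hn : HasDerivAt (fun s => (1 + a) * s) ((1 + a) * 1) s := (hasDerivAt_id s).const_mul _
    have hd : HasDerivAt (fun s => 1 + a * (k * s)) (a * (k * 1)) s :=
      (((hasDerivAt_id s).const_mul k).const_mul a).const_add 1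
    refine (hn.div hd h1.ne').hasDerivWithinAt.congr_deriv ?_
    congr 1
    ring
  have hinj : Set.InjOn (fun s => (1 + a) * s / (1 + a * (k * s))) (Set.Ioc 0 k⁻¹) := by
    intro s hs t ht hst
    have h1 := hpos s hs
    have h2 := hpos t ht
    simp only at hst
    rw [div_eq_div_iff h1.ne' h2.ne'] at hst
    have : (1 + a) * (s - t) = 0 := by linear_combination hst
    rcases mul_eq_zero.1 this with h | h <;> linarith
  have := lintegral_image_eq_lintegral_abs_deriv_mul measurableSet_Ioc hder hinj f
  rw [himg] at this
  rw [this]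
  refine setLIntegral_congr_fun measurableSet_Ioc fun s hs => ?_
  have h1 := hpos s hs
  rw [abs_of_nonneg (by positivity)]

lemma measurable_pullIn [MeasurableSpace E] [BorelSpace E] [SecondCountableTopology E]
    {K : Set E} (hK : Convex ℝ K) (h0 : K ∈ 𝓝 (0 : E)) (a : ℝ) : Measurable (pullIn K a) := by
  have : Measurable (gauge K) := (continuous_gauge hK h0).measurable
  unfold pullIn
  fun_prop

/-- The change of variables formula for `pullIn`. -/
lemma lintegral_pullIn [FiniteDimensional ℝ E] [MeasurableSpace E] [BorelSpace E]
    [Nontrivial E] (μ : Measure E) [μ.IsAddHaarMeasure] {K : Set E} (hK : Convex ℝ K)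
    (h0 : K ∈ 𝓝 (0 : E)) (hKc : IsClosed K) (hKb : Bornology.IsBounded K) {a : ℝ} (ha : 0 ≤ a)
    {g : E → ℝ≥0∞} (hg : Measurable g) :
    ∫⁻ z in K, g (pullIn K a z) ∂μ = ∫⁻ x in K, ENNReal.ofReal ((1 + a) ^ Module.finrank ℝ E /
      (1 + a * gauge K x) ^ (Module.finrank ℝ E + 1)) * g x ∂μ := by
  have hρ : Measurable (gauge K) := (continuous_gauge hK h0).measurable
  have hS := measurable_pullIn hK h0 a
  have hKm : MeasurableSet K := hKc.measurableSet
  obtain ⟨n, hn⟩ : ∃ n, Module.finrank ℝ E = n + 1 :=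
    ⟨_, (Nat.succ_pred_eq_of_pos Module.finrank_pos).symm⟩
  rw [← lintegral_indicator hKm, ← lintegral_indicator hKm,
    lintegral_eq_lintegral_sphere μ (Measurable.indicator (by fun_prop) hKm),
    lintegral_eq_lintegral_sphere μ (Measurable.indicator (by fun_prop) hKm)]
  refine lintegral_congr fun θ => ?_
  have hθ : (θ : E) ≠ 0 := by
    intro h
    have := θ.2
    rw [h] at this
    simp at this
  set k := gauge K (θ : E) with hkdef
  have hk : 0 < k := (gauge_pos (absorbent_nhds_zero h0)
    ((NormedSpace.isVonNBounded_iff ℝ).2 hKb)).2 hθ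
  have hgr : ∀ r : ℝ, 0 ≤ r → gauge K (r • (θ : E)) = k * r := fun r hr => by
    rw [gauge_smul_of_nonneg hr, smul_eq_mul, mul_comm]
  have hmem : ∀ r : ℝ, 0 < r → (r • (θ : E) ∈ K ↔ r ∈ Set.Ioc 0 k⁻¹) := fun r hr => by
    rw [← hKc.closure_eq, ← gauge_le_one_iff_mem_closure hK h0, hgr r hr.le, Set.mem_Ioc,
      and_iff_right hr, le_inv_comm₀ hr hk, ← one_div, le_div_iff₀ hr]
  have hred : ∀ f : E → ℝ≥0∞, ∫⁻ r in Set.Ioi (0 : ℝ),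
      ENNReal.ofReal (r ^ (Module.finrank ℝ E - 1)) * K.indicator f (r • (θ : E)) =
      ∫⁻ r in Set.Ioc 0 k⁻¹, ENNReal.ofReal (r ^ n) * f (r • (θ : E)) := fun f => by
    rw [← lintegral_indicator measurableSet_Ioi, ← lintegral_indicator measurableSet_Ioc]
    refine lintegral_congr fun r => ?_
    by_cases hr : 0 < r
    · rw [Set.indicator_of_mem (Set.mem_Ioi.2 hr), hn, Nat.add_sub_cancel]
      by_cases h : r ∈ Set.Ioc 0 k⁻¹
      · rw [Set.indicator_of_mem h, Set.indicator_of_mem ((hmem r hr).2 h)]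
      · rw [Set.indicator_of_notMem h, Set.indicator_of_notMem fun h' => h ((hmem r hr).1 h'),
          mul_zero]
    · rw [Set.indicator_of_notMem (by simpa using hr),
        Set.indicator_of_notMem fun h => hr h.1]
  rw [hred, hred, lintegral_ray_change ha hk]
  refine setLIntegral_congr_fun measurableSet_Ioc fun s hs => ?_
  have hs0 := hs.1
  have hpos : 0 < 1 + a * (k * s) := by positivity
  have hinv : pullIn K a (((1 + a) * s / (1 + a * (k * s))) • (θ : E)) = s • (θ : E) := by
    rw [pullIn, hgr _ (by positivity), smul_smul]
    congr 1
    have : 1 + a - a * (k * ((1 + a) * s / (1 + a * (k * s)))) = (1 + a) / (1 + a * (k * s)) := by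
      field_simp; ring
    rw [this]
    field_simp
  rw [hinv, hgr s hs0.le, hn]
  generalize 1 + a * (k * s) = c at hpos ⊢
  rw [← mul_assoc, ← mul_assoc, ← ENNReal.ofReal_mul (by positivity),
    ← ENNReal.ofReal_mul (by positivity)]
  congr 2
  rw [div_pow, mul_pow]
  field_simp
  ring

end Radial

/-! ### The inner part of the body is covered with high probability -/

/-- If every finite set that meets all of the sets `B j` has `L` in its convex hull, then adding `L`
to the hull changes the expected missed measure by an exponentially small amount only. -/
lemma expectedMiss_le_expectedMiss_union_add {E ι : Type*} [AddCommGroup E] [Module ℝ E]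
    [MeasurableSpace E] (σ : Measure E) [IsProbabilityMeasure σ] {L : Set E} (t : Finset ι)
    {B : ι → Set E} (hB : ∀ j ∈ t, MeasurableSet (B j)) {γ : ℝ≥0∞}
    (hγ : ∀ j ∈ t, σ (B j)ᶜ ≤ γ)
    (hL : ∀ C : Set E, C.Finite → (∀ j ∈ t, ¬ Disjoint C (B j)) → L ⊆ convexHull ℝ C)
    (n : ℕ) {C : Set E} (hC : C.Finite) :
    expectedMiss σ σ n C ≤ expectedMiss σ σ n (L ∪ C) +
      ∑ j ∈ t, Set.indicator {D | Disjoint D (B j)} (fun _ => γ ^ n) C := by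
  classical
  induction n generalizing C with
  | zero =>
    by_cases h : ∀ j ∈ t, ¬ Disjoint C (B j)
    · refine le_add_right (expectedMiss_anti_of_subset_convexHull σ σ 0 ?_)
      exact Set.union_subset (hL C hC h) (subset_convexHull ℝ C)
    · push Not at h
      obtain ⟨j, hj, hd⟩ := h
      refine (expectedMiss_le_one σ σ 0 C).trans (le_add_left ?_)
      refine le_trans ?_ (Finset.single_le_sum (f := fun j => Set.indicator
        {D | Disjoint D (B j)} (fun _ => γ ^ 0) C) (fun _ _ => zero_le) hj)
      rw [Set.indicator_of_mem (show C ∈ {D | Disjoint D (B j)} from hd), pow_zero]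
  | succ n ih =>
    have hind : ∀ j x, Set.indicator {D | Disjoint D (B j)} (fun _ => γ ^ n) (insert x C) =
        Set.indicator {D | Disjoint D (B j)} (fun _ => γ ^ n) C *
          Set.indicator (B j)ᶜ (fun _ => 1) x := fun j x => by
      by_cases h1 : Disjoint C (B j) <;> by_cases h2 : x ∈ B j <;>
        simp [Set.indicator, Set.disjoint_insert_left, h1, h2]
    calc expectedMiss σ σ (n + 1) C
        ≤ ∫⁻ x, (expectedMiss σ σ n (insert x (L ∪ C)) +
            ∑ j ∈ t, Set.indicator {D | Disjoint D (B j)} (fun _ => γ ^ n) C *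
              Set.indicator (B j)ᶜ (fun _ => 1) x) ∂σ := by
          refine lintegral_mono fun x => ?_
          refine (ih (hC.insert x)).trans_eq ?_
          simp only [hind, Set.union_insert]
      _ = expectedMiss σ σ (n + 1) (L ∪ C) +
            ∑ j ∈ t, Set.indicator {D | Disjoint D (B j)} (fun _ => γ ^ n) C * σ (B j)ᶜ := by
          have hm : ∀ j ∈ t, Measurable fun x => Set.indicator (B j)ᶜ (fun _ => (1 : ℝ≥0∞)) x :=
            fun j hj => measurable_const.indicator (hB j hj).compl
          rw [lintegral_add_right _ (Finset.measurable_sum _ fun j hj => (hm j hj).const_mul _),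
            lintegral_finsetSum' _ fun j hj => ((hm j hj).const_mul _).aemeasurable,
            expectedMiss_succ]
          congr 1
          refine Finset.sum_congr rfl fun j hj => ?_
          rw [lintegral_const_mul _ (hm j hj), lintegral_indicator (hB j hj).compl,
            setLIntegral_const, one_mul]
      _ ≤ _ := by
          gcongr with j hj
          by_cases h1 : Disjoint C (B j)
          · simp only [Set.indicator, Set.mem_ofPred_eq, h1, if_true, pow_succ]
            gcongr
            exact hγ j hj
          · simp [Set.indicator, h1]

/-- A closed convex set `D` that meets all balls of a fine net has the inner part of `K` as a
subset: a ball about a point outside `D` contains a ball of half the radius that is disjoint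
from `D`. -/
lemma exists_net_subset_convexHull {E : Type*} [NormedAddCommGroup E] [InnerProductSpace ℝ E]
    [FiniteDimensional ℝ E] {K : Set E} (hK : Convex ℝ K) (h0 : K ∈ 𝓝 (0 : E))
    (hKc : IsCompact K) {η : ℝ} (hη : 0 < η) :
    ∃ δ > 0, ∃ t : Finset E, (∀ p ∈ t, Metric.ball p δ ⊆ K) ∧
      ∀ C : Set E, C.Finite → (∀ p ∈ t, ¬ Disjoint C (Metric.ball p δ)) →
        {x | gauge K x ≤ 1 - η} ⊆ convexHull ℝ C := by
  classical
  obtain ⟨r, hr, hrK⟩ := Metric.mem_nhds_iff.1 h0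
  have hmemK : ∀ z, gauge K z ≤ 1 → z ∈ K := fun z hz => by
    rw [← hKc.isClosed.closure_eq]
    exact (gauge_le_one_iff_mem_closure hK h0).1 hz
  have hball : ∀ y, gauge K y ≤ 1 - η → Metric.ball y (η * r) ⊆ K := fun y hy z hz => by
    refine hmemK z ?_
    have h1 : gauge K z ≤ gauge K y + gauge K (z - y) := by
      simpa using gauge_add_le hK (absorbent_nhds_zero h0) y (z - y)
    have h2 : r * gauge K (z - y) ≤ ‖z - y‖ := mul_gauge_le_norm hrK
    rw [Metric.mem_ball, dist_eq_norm] at hz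
    have h3 : r * gauge K (z - y) ≤ r * η := by linarith
    have := le_of_mul_le_mul_left h3 hr
    linarith
  set δ := η * r / 4 with hδ
  have hδ0 : 0 < δ := by positivity
  obtain ⟨t, htK, ht⟩ := hKc.finite_cover_balls hδ0
  have htf := ht.1
  refine ⟨δ, hδ0, htf.toFinset.filter fun p => Metric.ball p δ ⊆ K, by simp, ?_⟩
  intro C hC hhit y hy
  have hnet : ∀ c, Metric.ball c (2 * δ) ⊆ K → ∃ x ∈ C, x ∈ Metric.ball c (2 * δ) := fun c hc => by
    obtain ⟨p, hp, hcp⟩ := Set.mem_iUnion₂.1 (ht.2 (hc (Metric.mem_ball_self (by positivity))))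
    have hsub : Metric.ball p δ ⊆ Metric.ball c (2 * δ) := by
      refine Metric.ball_subset_ball' ?_
      rw [Metric.mem_ball, dist_comm] at hcp
      linarith
    have := hhit p (by simpa using ⟨hp, hsub.trans hc⟩)
    obtain ⟨x, hx, hxp⟩ := Set.not_disjoint_iff.1 this
    exact ⟨x, hx, hsub hxp⟩
  by_contra hyC
  have hyK := hball y hy
  have hne : (convexHull ℝ C).Nonempty := by
    obtain ⟨x, hx, -⟩ := hnet y ((Metric.ball_subset_ball (by linarith)).trans hyK)
    exact ⟨x, subset_convexHull ℝ C hx⟩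
  obtain ⟨q, hq, hqy⟩ := exists_norm_eq_iInf_of_complete_convex hne
    (hC.isClosed_convexHull ℝ).isComplete (convex_convexHull ℝ C) y
  have hinner := (norm_eq_iInf_iff_real_inner_le_zero (convex_convexHull ℝ C) hq).1 hqy
  have hyq : 0 < ‖y - q‖ := norm_pos_iff.2 (sub_ne_zero.2 fun h => hyC (h ▸ hq))
  -- the ball of radius `2 δ` about `y + 2 δ u` lies beyond the hyperplane through `q` with normal `u`
  set u := ‖y - q‖⁻¹ • (y - q) with hu
  have hu1 : ‖u‖ = 1 := by
    rw [hu, norm_smul, norm_inv, norm_norm, inv_mul_cancel₀ hyq.ne']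
  obtain ⟨x, hx, hxc⟩ := hnet (y + (2 * δ) • u) (by
    refine (Metric.ball_subset_ball' ?_).trans hyK
    rw [dist_eq_norm, add_sub_cancel_left, norm_smul, hu1, Real.norm_of_nonneg (by positivity)]
    linarith)
  have h1 : inner ℝ u (x - q) ≤ 0 := by
    rw [hu, real_inner_smul_left]
    exact mul_nonpos_of_nonneg_of_nonpos (by positivity)
      (hinner x (subset_convexHull ℝ C hx))
  have h2 : inner ℝ u (y - q) = ‖y - q‖ := by
    rw [hu, real_inner_smul_left, real_inner_self_eq_norm_sq, sq, ← mul_assoc,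
      inv_mul_cancel₀ hyq.ne', one_mul]
  have h3 : inner ℝ u (y + (2 * δ) • u - x) = ‖y - q‖ + 2 * δ - inner ℝ u (x - q) := by
    have : y + (2 * δ) • u - x = (y - q) + (2 * δ) • u - (x - q) := by abel
    rw [this, inner_sub_right, inner_add_right, real_inner_smul_right, h2,
      real_inner_self_eq_norm_sq, hu1]
    ring
  have h4 : inner ℝ u (y + (2 * δ) • u - x) ≤ ‖y + (2 * δ) • u - x‖ := by
    simpa [hu1] using real_inner_le_norm u (y + (2 * δ) • u - x)
  rw [Metric.mem_ball, dist_comm, dist_eq_norm] at hxc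
  linarith

/-! ### Doubling -/

section Doubling

variable {E : Type*} [NormedAddCommGroup E] [MeasurableSpace E] [BorelSpace E]

/-- The law of the image under `pullIn` of a uniform point. -/
lemma map_pullIn [NormedSpace ℝ E] [FiniteDimensional ℝ E] [Nontrivial E] (μ : Measure E)
    [μ.IsAddHaarMeasure] {K : Set E} (hK : Convex ℝ K)
    (h0 : K ∈ 𝓝 (0 : E)) (hKc : IsCompact K) {a : ℝ} (ha : 0 ≤ a) :
    (μ.restrict K).map (pullIn K a) = (μ.restrict K).withDensity fun x =>
      ENNReal.ofReal ((1 + a) ^ Module.finrank ℝ E /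
        (1 + a * gauge K x) ^ (Module.finrank ℝ E + 1)) := by
  ext B hB
  have h := lintegral_pullIn μ hK h0 hKc.isClosed hKc.isBounded ha
    (measurable_const.indicator hB : Measurable (B.indicator fun _ => (1 : ℝ≥0∞)))
  have hS := measurable_pullIn hK h0 a
  rw [Measure.map_apply hS hB, withDensity_apply _ hB, ← lintegral_indicator_one (hS hB),
    ← lintegral_indicator hB]
  refine (Eq.trans (lintegral_congr fun x => ?_) h).trans (lintegral_congr fun x => ?_)
  · by_cases hx : pullIn K a x ∈ B <;> simp [Set.indicator, hx]
  · by_cases hx : x ∈ B <;> simp [hx]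

lemma smul_le_map_pullIn [NormedSpace ℝ E] [FiniteDimensional ℝ E] [Nontrivial E] (μ : Measure E)
    [μ.IsAddHaarMeasure] {K : Set E} (hK : Convex ℝ K)
    (h0 : K ∈ 𝓝 (0 : E)) (hKc : IsCompact K) {a : ℝ} (ha : 0 ≤ a) :
    ENNReal.ofReal (1 / (1 + a)) • μ.restrict K ≤ (μ.restrict K).map (pullIn K a) := by
  rw [map_pullIn μ hK h0 hKc ha, ← withDensity_const]
  refine withDensity_mono ((ae_restrict_iff' hKc.measurableSet).2 (ae_of_all _ fun x hx => ?_))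
  have h1 : 1 + a * gauge K x ≤ 1 + a := by
    have := mul_le_mul_of_nonneg_left (gauge_le_one_of_mem hx) ha
    linarith
  have h2 : 0 < 1 + a * gauge K x := by
    have := mul_nonneg ha (gauge_nonneg (s := K) x)
    linarith
  refine ENNReal.ofReal_le_ofReal ?_
  rw [div_le_div_iff₀ (by positivity) (by positivity), one_mul, ← pow_succ]
  gcongr

/-- Close to the boundary the density of the law of the image points is at most `1 / 4`. -/
lemma map_pullIn_restrict_le [NormedSpace ℝ E] [FiniteDimensional ℝ E] [Nontrivial E]
    (μ : Measure E) [μ.IsAddHaarMeasure] {K : Set E} (hK : Convex ℝ K)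
    (h0 : K ∈ 𝓝 (0 : E)) (hKc : IsCompact K) :
    ((μ.restrict K).map (pullIn K 7)).restrict
        {x | gauge K x ≤ 1 - 1 / (2 * (Module.finrank ℝ E + 1))}ᶜ ≤
      ENNReal.ofReal (1 / 4) • (μ.restrict K).restrict
        {x | gauge K x ≤ 1 - 1 / (2 * (Module.finrank ℝ E + 1))}ᶜ := by
  have hL : MeasurableSet {x | gauge K x ≤ 1 - 1 / (2 * (Module.finrank ℝ E + 1 : ℝ))} :=
    measurableSet_le (continuous_gauge hK h0).measurable measurable_const
  rw [map_pullIn μ hK h0 hKc (by norm_num), restrict_withDensity hL.compl, ← withDensity_const]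
  refine withDensity_mono ((ae_restrict_iff' hL.compl).2 (ae_of_all _ fun x hx => ?_))
  simp only [Set.mem_compl_iff, Set.mem_ofPred_eq, not_le] at hx
  refine ENNReal.ofReal_le_ofReal ?_
  set d := Module.finrank ℝ E
  set η : ℝ := 1 / (2 * (d + 1)) with hη
  have hdη : ((d : ℝ) + 1) * η = 1 / 2 := by rw [hη]; field_simp
  have hη1 : η ≤ 1 / 2 := by
    rw [hη]
    refine one_div_le_one_div_of_le (by norm_num) ?_
    have : (0 : ℝ) ≤ d := Nat.cast_nonneg d
    linarith
  -- Bernoulli's inequality; the factor `7 / 8` makes `8 * (1 - 7 / 8 * η) = 1 + 7 * (1 - η)`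
  have hbern : (1 : ℝ) / 2 ≤ (1 - 7 / 8 * η) ^ (d + 1) := by
    have := one_add_mul_le_pow (a := -(7 / 8 * η)) (by linarith) (d + 1)
    rw [← sub_eq_add_neg] at this
    push_cast at this
    nlinarith
  have h8 : (8 : ℝ) * (1 - 7 / 8 * η) ≤ 1 + 7 * gauge K x := by linarith
  have hpow : (8 * (1 - 7 / 8 * η)) ^ (d + 1) ≤ (1 + 7 * gauge K x) ^ (d + 1) :=
    pow_le_pow_left₀ (by linarith) h8 _
  rw [mul_pow, pow_succ (8 : ℝ) d] at hpow
  have hp : (0 : ℝ) < 8 ^ d := by positivity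
  have hlow : (8 : ℝ) ^ d * 4 ≤ (1 + 7 * gauge K x) ^ (d + 1) := by
    nlinarith
  rw [div_le_div_iff₀ (by linarith) (by norm_num), show (1 : ℝ) + 7 = 8 by norm_num]
  linarith

/-- Replacing uniform points by their images under `pullIn` and adding the centre to the hull costs
at most the factor `1 + a`, the largest factor by which `pullIn` expands volumes. -/
lemma expectedMiss_pullIn_le [NormedSpace ℝ E] [FiniteDimensional ℝ E] [Nontrivial E]
    (μ : Measure E) [μ.IsAddHaarMeasure] {K : Set E} (hK : Convex ℝ K)
    (h0 : K ∈ 𝓝 (0 : E)) (hKc : IsCompact K) {a : ℝ} (ha : 0 ≤ a) (n : ℕ) {C : Set E}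
    (hC : C ⊆ K) :
    ENNReal.ofReal (1 / (1 + a)) * expectedMiss ((μ.restrict K).map (pullIn K a))
      (μ.restrict K) n (insert 0 (pullIn K a '' C)) ≤
      expectedMiss (μ.restrict K) (μ.restrict K) n C := by
  have hS := measurable_pullIn hK h0 a
  induction n generalizing C with
  | zero =>
    have hnull : NullMeasurableSet (convexHull ℝ (insert 0 (pullIn K a '' C)))ᶜ
        ((μ.restrict K).map (pullIn K a)) := by
      refine ((convex_convexHull ℝ _).nullMeasurableSet μ).compl.mono_ac ?_
      rw [map_pullIn μ hK h0 hKc ha]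
      exact (withDensity_absolutelyContinuous _ _).trans Measure.restrict_le_self.absolutelyContinuous
    simp only [expectedMiss_zero]
    calc _ ≤ (μ.restrict K).map (pullIn K a) (convexHull ℝ (insert 0 (pullIn K a '' C)))ᶜ :=
          smul_le_map_pullIn μ hK h0 hKc ha _
      _ = μ.restrict K (pullIn K a ⁻¹' (convexHull ℝ (insert 0 (pullIn K a '' C)))ᶜ) :=
          Measure.map_apply₀ hS.aemeasurable hnull
      _ ≤ _ := measure_mono fun z hz hzC => hz (pullIn_mem_convexHull hK h0 ha hC hzC)
  | succ n ih =>
    simp only [expectedMiss_succ]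
    calc _ ≤ ENNReal.ofReal (1 / (1 + a)) * ∫⁻ z in K, expectedMiss
            ((μ.restrict K).map (pullIn K a)) (μ.restrict K) n
            (insert (pullIn K a z) (insert 0 (pullIn K a '' C))) ∂μ := by
          refine mul_le_mul' le_rfl ?_
          exact lintegral_map_le (μ := μ.restrict K) (fun w => expectedMiss
            ((μ.restrict K).map (pullIn K a)) (μ.restrict K) n
            (insert w (insert 0 (pullIn K a '' C)))) (pullIn K a)
      _ = ∫⁻ z in K, ENNReal.ofReal (1 / (1 + a)) * expectedMiss
            ((μ.restrict K).map (pullIn K a)) (μ.restrict K) n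
            (insert (pullIn K a z) (insert 0 (pullIn K a '' C))) ∂μ :=
          (lintegral_const_mul' _ _ ENNReal.ofReal_ne_top).symm
      _ ≤ _ := setLIntegral_mono' hKc.measurableSet fun z hz => by
          rw [Set.insert_comm, ← Set.image_insert_eq]
          exact ih (Set.insert_subset hz hC)


open scoped Pointwise in
/-- The expected missed measure decays more slowly than any given geometric sequence: the points
may all lie in a dilate of `K` of measure `κ`. -/
lemma geometric_le_expectedMiss [NormedSpace ℝ E] [FiniteDimensional ℝ E] [Nontrivial E]
    (μ : Measure E) [μ.IsAddHaarMeasure] {K : Set E} (hK : Convex ℝ K)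
    (h0 : K ∈ 𝓝 (0 : E)) (hKc : IsCompact K) (hμ : μ K = 1) {κ : ℝ} (hκ0 : 0 ≤ κ) (hκ1 : κ ≤ 1)
    (n : ℕ) : ENNReal.ofReal (1 - κ) * ENNReal.ofReal κ ^ n ≤
      expectedMiss (μ.restrict K) (μ.restrict K) n ∅ := by
  have hd : Module.finrank ℝ E ≠ 0 := Module.finrank_pos.ne'
  set t : ℝ := κ ^ (Module.finrank ℝ E : ℝ)⁻¹ with ht
  have ht0 : 0 ≤ t := Real.rpow_nonneg hκ0 _
  have ht1 : t ≤ 1 := Real.rpow_le_one hκ0 hκ1 (by positivity)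
  have htd : t ^ Module.finrank ℝ E = κ := Real.rpow_inv_natCast_pow hκ0 hd
  have hsub : t • K ⊆ K := by
    rintro _ ⟨x, hx, rfl⟩
    exact hK.smul_mem_of_zero_mem (mem_of_mem_nhds h0) hx ⟨ht0, ht1⟩
  have hQm : MeasurableSet (t • K) := (hKc.smul t).measurableSet
  have hQ : μ.restrict K (t • K) = ENNReal.ofReal κ := by
    rw [Measure.restrict_apply hQm, Set.inter_eq_left.2 hsub, Measure.addHaar_smul_of_nonneg _ ht0,
      htd, hμ, mul_one]
  have hprob : IsProbabilityMeasure (μ.restrict K) := ⟨by simpa using hμ⟩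
  have := mul_pow_le_expectedMiss (μ.restrict K) (hK.smul t) hQm n (Set.empty_subset _)
  rwa [prob_compl_eq_one_sub hQm, hQ, ← ENNReal.ofReal_one, ← ENNReal.ofReal_sub _ hκ0] at this

/-- Halving the number of points increases the expected missed volume at most by a constant
factor. -/
theorem exists_expectedMiss_half_le [InnerProductSpace ℝ E] [FiniteDimensional ℝ E] [Nontrivial E]
    (μ : Measure E) [μ.IsAddHaarMeasure] {K : Set E} (hK : Convex ℝ K)
    (h0 : K ∈ 𝓝 (0 : E)) (hKc : IsCompact K) (hμ : μ K = 1) :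
    ∃ A : ℝ, ∀ n, (expectedMiss (μ.restrict K) (μ.restrict K) (n / 2) ∅).toReal ≤
      A * (expectedMiss (μ.restrict K) (μ.restrict K) n ∅).toReal := by
  have hprob : IsProbabilityMeasure (μ.restrict K) := ⟨by simpa using hμ⟩
  have hS := measurable_pullIn hK h0 7
  set σ := μ.restrict K with hσ
  set ν := σ.map (pullIn K 7) with hν
  have hprobν : IsProbabilityMeasure ν := Measure.isProbabilityMeasure_map hS.aemeasurable
  have hle := map_pullIn_restrict_le μ hK h0 hKc
  set η : ℝ := 1 / (2 * (Module.finrank ℝ E + 1)) with hη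
  have hη0 : 0 < η := by positivity
  have hη1 : η ≤ 1 := by
    rw [hη, div_le_one (by positivity)]
    have : (0 : ℝ) ≤ Module.finrank ℝ E := Nat.cast_nonneg _
    linarith
  set L := {x | gauge K x ≤ 1 - η} with hL
  have hLm : MeasurableSet L :=
    measurableSet_le (continuous_gauge hK h0).measurable measurable_const
  have h0L : (0 : E) ∈ L := by simpa [hL] using hη1
  have hne : ∀ (n : ℕ) (C : Set E), expectedMiss σ σ n C ≠ ∞ := fun n C =>
    ne_top_of_le_ne_top ENNReal.one_ne_top (expectedMiss_le_one σ σ n C)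
  -- the comparison of `n` points with `n / 2` points and the set `L`
  have hcmp : ∀ n, (expectedMiss σ σ (n / 2) L).toReal ≤ 16 * (expectedMiss σ σ n ∅).toReal := by
    intro n
    have h1 := expectedMiss_pullIn_le μ hK h0 hKc (a := 7) (by norm_num) n (Set.empty_subset K)
    rw [Set.image_empty, ← hσ, ← hν] at h1
    have h2 : expectedMiss ν σ n L ≤ expectedMiss ν σ n (insert 0 ∅) :=
      expectedMiss_anti ν σ n (by simpa using h0L)
    have h3 := binomialAverage_le_expectedMiss (μ := σ) hLm (by simp) hle n (le_refl L)
    have h4 := half_le_toReal_binomialAverage n (u := fun k => expectedMiss σ σ k L)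
      (fun k => expectedMiss_le_one σ σ k L) (antitone_expectedMiss σ σ L)
    have h5 : ENNReal.ofReal (1 / (1 + 7)) * binomialAverage (1 - ENNReal.ofReal (1 / 4))
        (ENNReal.ofReal (1 / 4)) n (fun k => expectedMiss σ σ k L) ≤ expectedMiss σ σ n ∅ :=
      le_trans (by gcongr; exact h3.trans h2) h1
    have h6 := ENNReal.toReal_mono (hne n ∅) h5
    rw [ENNReal.toReal_mul, ENNReal.toReal_ofReal (by norm_num)] at h6
    linarith
  -- the set `L` is covered up to an exponentially small probability
  obtain ⟨δ, hδ, t, htK, htL⟩ := exists_net_subset_convexHull hK h0 hKc hη0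
  set v := μ (Metric.ball (0 : E) δ) with hv
  have hv0 : 0 < v := Metric.measure_ball_pos μ 0 hδ
  have hvlt : (1 - v).toReal < 1 := by
    have : 1 - v < 1 := ENNReal.sub_lt_self ENNReal.one_ne_top one_ne_zero hv0.ne'
    exact (ENNReal.toReal_lt_toReal (by simp) ENNReal.one_ne_top).2 this
  have hB : ∀ p ∈ t, σ (Metric.ball p δ)ᶜ ≤ 1 - v := fun p hp => by
    rw [prob_compl_eq_one_sub measurableSet_ball, hσ, Measure.restrict_apply measurableSet_ball,
      Set.inter_eq_left.2 (htK p hp), Measure.addHaar_ball_center]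
  set γ := (1 - v).toReal with hγ
  have hγ0 : 0 ≤ γ := ENNReal.toReal_nonneg
  have hcov : ∀ n, (expectedMiss σ σ n ∅).toReal ≤
      (expectedMiss σ σ n L).toReal + t.card * γ ^ n := by
    intro n
    have h1 := expectedMiss_le_expectedMiss_union_add σ (L := L) t (B := fun p => Metric.ball p δ)
      (fun _ _ => measurableSet_ball) hB htL n Set.finite_empty
    have h2 : ∑ j ∈ t, Set.indicator {D | Disjoint D (Metric.ball j δ)}
        (fun _ => (1 - v) ^ n) (∅ : Set E) = t.card * (1 - v) ^ n := by
      rw [← nsmul_eq_mul, ← Finset.sum_const]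
      refine Finset.sum_congr rfl fun j _ => ?_
      rw [Set.indicator_of_mem]
      exact Set.empty_disjoint _
    rw [h2, Set.union_empty] at h1
    have h3 : (t.card : ℝ≥0∞) * (1 - v) ^ n ≠ ∞ :=
      ENNReal.mul_ne_top (by simp) (ENNReal.pow_ne_top (by simp))
    have := ENNReal.toReal_mono (ENNReal.add_ne_top.2 ⟨hne n L, h3⟩) h1
    rwa [ENNReal.toReal_add (hne n L) h3, ENNReal.toReal_mul, ENNReal.toReal_pow,
      ENNReal.toReal_natCast] at this
  -- the exponentially small probability is negligible
  obtain ⟨κ, hκ1, hκ0, hκγ⟩ : ∃ κ : ℝ, κ < 1 ∧ 0 < κ ∧ γ ≤ κ ^ 2 := by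
    refine ⟨√((1 + γ) / 2), ?_, Real.sqrt_pos.2 (by positivity), ?_⟩
    · rw [Real.sqrt_lt' one_pos]; linarith
    · rw [Real.sq_sqrt (by positivity)]; linarith
  have hlow : ∀ n, (1 - κ) * κ ^ n ≤ (expectedMiss σ σ n ∅).toReal := fun n => by
    have := ENNReal.toReal_mono (hne n ∅)
      (geometric_le_expectedMiss μ hK h0 hKc hμ hκ0.le hκ1.le n)
    rwa [ENNReal.toReal_mul, ENNReal.toReal_pow, ENNReal.toReal_ofReal (by linarith),
      ENNReal.toReal_ofReal hκ0.le] at this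
  refine ⟨16 + t.card / (κ * (1 - κ)), fun n => ?_⟩
  have h1 := hcov (n / 2)
  have h2 := hcmp n
  have h3 : γ ^ (n / 2) * κ ≤ κ ^ n := by
    calc γ ^ (n / 2) * κ ≤ (κ ^ 2) ^ (n / 2) * κ := by gcongr
      _ = κ ^ (2 * (n / 2) + 1) := by rw [pow_succ κ (2 * (n / 2)), pow_mul]
      _ ≤ κ ^ n := pow_le_pow_of_le_one hκ0.le hκ1.le (by omega)
  have h4 : γ ^ (n / 2) * (κ * (1 - κ)) ≤ (expectedMiss σ σ n ∅).toReal := by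
    refine le_trans ?_ (hlow n)
    nlinarith
  have h5 : 0 < κ * (1 - κ) := mul_pos hκ0 (by linarith)
  have h6 : (t.card : ℝ) * γ ^ (n / 2) ≤
      t.card / (κ * (1 - κ)) * (expectedMiss σ σ n ∅).toReal := by
    rw [div_mul_eq_mul_div, le_div_iff₀ h5, mul_assoc]
    gcongr
  rw [add_mul]
  linarith

end Doubling

/-! ### Sequences of independent points -/

/-- The sequence with first term `z` followed by the terms of `x`. -/
def consSeq {E : Type*} (z : E) (x : ℕ → E) : ℕ → E
  | 0 => z
  | i + 1 => x i

lemma measurable_consSeq {E : Type*} [MeasurableSpace E] :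
    Measurable fun p : E × (ℕ → E) => consSeq p.1 p.2 := by
  refine measurable_pi_lambda _ fun i => ?_
  cases i with
  | zero => exact measurable_fst
  | succ i => exact (measurable_pi_apply i).comp measurable_snd

/-- A sequence of independent points arises from such a sequence by adding an independent first
point. -/
lemma map_consSeq_infinitePi {E : Type*} [MeasurableSpace E] (σ : Measure E)
    [IsProbabilityMeasure σ] :
    (σ.prod (Measure.infinitePi fun _ : ℕ => σ)).map (fun p => consSeq p.1 p.2) =
      Measure.infinitePi fun _ : ℕ => σ := by
  classical
  refine Measure.eq_infinitePi _ fun s t ht => ?_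
  obtain ⟨N, hN⟩ := s.exists_nat_subset_range
  set t' : ℕ → Set E := fun i => if i ∈ s then t i else Set.univ with ht'
  have hm : ∀ i, MeasurableSet (t' i) := fun i => by
    simp only [ht']; split_ifs
    exacts [ht i, MeasurableSet.univ]
  have hset : Set.pi (s : Set ℕ) t = Set.pi (Finset.range (N + 1) : Set ℕ) t' := by
    ext x
    simp only [Set.mem_pi, ht']
    constructor
    · intro h i _
      split_ifs with hi
      exacts [h i hi, trivial]
    · intro h i hi
      have := h i (by
        have := Finset.mem_range.1 (hN hi)
        simp; omega)
      rwa [if_pos (by simpa using hi)] at this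
  have hpre : (fun p : E × (ℕ → E) => consSeq p.1 p.2) ⁻¹' Set.pi (Finset.range (N + 1)) t' =
      t' 0 ×ˢ Set.pi (Finset.range N : Set ℕ) fun i => t' (i + 1) := by
    ext ⟨z, x⟩
    simp only [Set.mem_preimage, Set.mem_pi, Set.mem_prod, Finset.coe_range, Set.mem_Iio]
    constructor
    · exact fun h => ⟨h 0 (by omega), fun i hi => h (i + 1) (by omega)⟩
    · rintro ⟨h0, h⟩ (_ | i) hi
      · exact h0
      · exact h i (by omega)
  rw [hset, Measure.map_apply measurable_consSeq
    (.pi (Finset.countable_toSet _) fun i _ => hm i), hpre, Measure.prod_prod,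
    Measure.infinitePi_pi _ fun i _ => hm (i + 1), mul_comm,
    ← Finset.prod_range_succ' fun i => σ (t' i)]
  have h1 : ∏ i ∈ s, σ (t i) = ∏ i ∈ s, σ (t' i) :=
    Finset.prod_congr rfl fun i hi => by simp [ht', hi]
  rw [h1]
  refine (Finset.prod_subset (hN.trans (Finset.range_mono (Nat.le_succ N))) fun i _ hi => ?_).symm
  simp [ht', hi]

/-- Exchangeability of independent identically distributed points. -/
lemma map_comp_equiv_infinitePi {E : Type*} [MeasurableSpace E] (σ : Measure E)
    [IsProbabilityMeasure σ] (e : Equiv.Perm ℕ) :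
    (Measure.infinitePi fun _ : ℕ => σ).map (fun x => x ∘ e) =
      Measure.infinitePi fun _ : ℕ => σ := by
  have h := Measure.infinitePi_map_piCongrLeft (fun _ : ℕ => σ) e.symm
  have h2 : ⇑(MeasurableEquiv.piCongrLeft (fun _ : ℕ => E) e.symm) = fun x => x ∘ e := by
    funext x i
    have := Equiv.piCongrLeft_apply_apply (P := fun _ : ℕ => E) (e := e.symm) x (e i)
    simpa [MeasurableEquiv.coe_piCongrLeft] using this
  rwa [h2] at h

section Link

variable {d : ℕ}

lemma measurable_measure_compl_convexHull (σ : Measure (EuclideanSpace ℝ (Fin d)))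
    [IsProbabilityMeasure σ] (n : ℕ) {C : Set (EuclideanSpace ℝ (Fin d))} (hC : C.Finite) :
    Measurable fun x : ℕ → EuclideanSpace ℝ (Fin d) =>
      σ (convexHull ℝ (C ∪ x '' Set.Iio n))ᶜ := by
  -- the points of `C` are put in front of the sequence, which reduces the claim to `polytope`
  obtain ⟨m, f, -, rfl⟩ := hC.fin_param
  let g : (ℕ → EuclideanSpace ℝ (Fin d)) → ℕ → EuclideanSpace ℝ (Fin d) := fun x i =>
    if h : i < m then f ⟨i, h⟩ else x (i - m)
  have hg : Measurable g := by
    refine measurable_pi_lambda _ fun i => ?_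
    by_cases h : i < m
    · simp [g, h]
    · simpa [g, h] using measurable_pi_apply (i - m)
  have hs : MeasurableSet {p : (ℕ → EuclideanSpace ℝ (Fin d)) × EuclideanSpace ℝ (Fin d) |
      p.2 ∈ polytope (m + n) p.1}ᶜ := (isClosed_polytope (m + n)).measurableSet.compl
  have h := (measurable_measure_prodMk_left (ν := σ) hs).comp hg
  convert h using 2 with x
  simp only [Function.comp]
  congr 1
  have : Set.range f ∪ x '' Set.Iio n = g x '' Set.Iio (m + n) := by
    ext y
    simp only [Set.mem_union, Set.mem_range, Set.mem_image, Set.mem_Iio]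
    constructor
    · rintro (⟨i, rfl⟩ | ⟨i, hi, rfl⟩)
      · exact ⟨i, by omega, by simp [g]⟩
      · exact ⟨m + i, by omega, by simp [g]⟩
    · rintro ⟨i, hi, rfl⟩
      by_cases h : i < m
      · exact Or.inl ⟨⟨i, h⟩, by simp [g, h]⟩
      · exact Or.inr ⟨i - m, by omega, by simp [g, h]⟩
  rw [this]
  rfl

lemma lintegral_measure_compl_convexHull (σ : Measure (EuclideanSpace ℝ (Fin d)))
    [IsProbabilityMeasure σ] (n : ℕ) {C : Set (EuclideanSpace ℝ (Fin d))} (hC : C.Finite) :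
    ∫⁻ x, σ (convexHull ℝ (C ∪ x '' Set.Iio n))ᶜ ∂(Measure.infinitePi fun _ : ℕ => σ) =
      expectedMiss σ σ n C := by
  induction n generalizing C with
  | zero =>
    simp [expectedMiss_zero]
  | succ n ih =>
    have hm := measurable_measure_compl_convexHull σ (n + 1) hC
    have hm' : Measurable fun p : EuclideanSpace ℝ (Fin d) × (ℕ → EuclideanSpace ℝ (Fin d)) =>
        σ (convexHull ℝ (C ∪ consSeq p.1 p.2 '' Set.Iio (n + 1)))ᶜ := hm.comp measurable_consSeq
    rw [← map_consSeq_infinitePi σ, lintegral_map hm measurable_consSeq,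
      lintegral_prod _ hm'.aemeasurable, expectedMiss_succ]
    refine lintegral_congr fun z => ?_
    rw [← ih (hC.insert z)]
    refine lintegral_congr fun x => ?_
    congr 3
    ext y
    simp only [Set.mem_union, Set.mem_image, Set.mem_Iio, Set.mem_insert_iff]
    constructor
    · rintro (h | ⟨_ | i, hi, rfl⟩)
      · exact Or.inl (Or.inr h)
      · exact Or.inl (Or.inl rfl)
      · exact Or.inr ⟨i, by omega, rfl⟩
    · rintro ((rfl | h) | ⟨i, hi, rfl⟩)
      · exact Or.inr ⟨0, by omega, rfl⟩
      · exact Or.inl h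
      · exact Or.inr ⟨i + 1, by omega, rfl⟩

lemma uniformLaw_eq_restrict (K : ConvexBody (EuclideanSpace ℝ (Fin d)))
    (hK : volume (K : Set (EuclideanSpace ℝ (Fin d))) = 1) :
    uniformLaw K = volume.restrict (K : Set (EuclideanSpace ℝ (Fin d))) := by
  simp [uniformLaw, ProbabilityTheory.cond, hK]

lemma uniformExpectedMissedVolume_eq (K : ConvexBody (EuclideanSpace ℝ (Fin d)))
    (hK : volume (K : Set (EuclideanSpace ℝ (Fin d))) = 1) (n : ℕ) :
    uniformExpectedMissedVolume K n =
      (expectedMiss (volume.restrict (K : Set (EuclideanSpace ℝ (Fin d))))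
        (volume.restrict (K : Set (EuclideanSpace ℝ (Fin d)))) n ∅).toReal := by
  have := isProbabilityMeasure_uniformLaw K hK
  rw [← uniformLaw_eq_restrict K hK, ← lintegral_measure_compl_convexHull _ n Set.finite_empty,
    uniformExpectedMissedVolume, pointsLaw, integral_eq_lintegral_of_nonneg_ae
      (ae_of_all _ fun x => (missedVolume_mem_Icc K hK n x).1)
      (measurable_missedVolume K n).aestronglyMeasurable]
  congr 1
  refine lintegral_congr fun x => ?_
  have hfin : volume ((K : Set (EuclideanSpace ℝ (Fin d))) \ polytope n x) ≠ ∞ :=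
    ne_top_of_le_ne_top (by simp [hK]) (measure_mono Set.sdiff_subset)
  rw [missedVolume, Measure.real, ENNReal.ofReal_toReal hfin, uniformLaw_eq_restrict K hK,
    Measure.restrict_apply' K.isClosed.measurableSet, Set.empty_union, polytope,
    Set.sdiff_eq, Set.inter_comm]

/-! ### Translation to an interior point -/

open scoped Pointwise in
/-- Translation invariance, by which `0` may be assumed to be an interior point of the body. -/
lemma expectedMiss_map_vadd {E : Type*} [AddCommGroup E] [Module ℝ E] [MeasurableSpace E]
    [MeasurableAdd E] (σ : Measure E) (v : E) (n : ℕ) (C : Set E) :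
    expectedMiss (σ.map (v + ·)) (σ.map (v + ·)) n (v +ᵥ C) = expectedMiss σ σ n C := by
  induction n generalizing C with
  | zero =>
    rw [expectedMiss_zero, expectedMiss_zero, convexHull_vadd,
      ← MeasurableEquiv.coe_addLeft, MeasurableEquiv.map_apply]
    congr 1
    ext x
    simp [Set.mem_vadd_set]
  | succ n ih =>
    rw [expectedMiss_succ, expectedMiss_succ, ← MeasurableEquiv.coe_addLeft,
      lintegral_map_equiv, MeasurableEquiv.coe_addLeft]
    refine lintegral_congr fun x => ?_
    rw [← ih (insert x C)]
    congr 1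
    ext y
    simp [Set.mem_vadd_set, eq_comm]

lemma nonempty_interior_of_volume_eq_one (K : ConvexBody (EuclideanSpace ℝ (Fin d)))
    (hK : volume (K : Set (EuclideanSpace ℝ (Fin d))) = 1) :
    (interior (K : Set (EuclideanSpace ℝ (Fin d)))).Nonempty := by
  by_contra h
  rw [Set.not_nonempty_iff_eq_empty] at h
  have h1 := K.convex.addHaar_frontier volume
  rw [K.isClosed.frontier_eq, h, Set.sdiff_empty, hK] at h1
  exact one_ne_zero h1

open scoped Pointwise in
/-- Doubling and the geometric lower bound for the expected missed volume. -/
theorem uniformExpectedMissedVolume_bounds (hd : 1 ≤ d)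
    (K : ConvexBody (EuclideanSpace ℝ (Fin d)))
    (hK : volume (K : Set (EuclideanSpace ℝ (Fin d))) = 1) :
    (∃ A : ℝ, ∀ n, uniformExpectedMissedVolume K (n / 2) ≤ A * uniformExpectedMissedVolume K n) ∧
      ∀ κ : ℝ, 0 ≤ κ → κ ≤ 1 → ∀ n, (1 - κ) * κ ^ n ≤ uniformExpectedMissedVolume K n := by
  have : Nonempty (Fin d) := ⟨⟨0, hd⟩⟩
  have hKm : MeasurableSet (K : Set (EuclideanSpace ℝ (Fin d))) := K.isClosed.measurableSet
  obtain ⟨o, ho⟩ := nonempty_interior_of_volume_eq_one K hK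
  set K₀ : Set (EuclideanSpace ℝ (Fin d)) := -o +ᵥ (K : Set (EuclideanSpace ℝ (Fin d))) with hK₀
  have hconv : Convex ℝ K₀ := K.convex.vadd (-o)
  have hcomp : IsCompact K₀ := K.isCompact.vadd (-o)
  have hnhds : K₀ ∈ 𝓝 (0 : EuclideanSpace ℝ (Fin d)) := by
    have h := vadd_mem_nhds_vadd (a := o) (-o) (mem_interior_iff_mem_nhds.1 ho)
    simpa using h
  have hvol : volume K₀ = 1 := by rw [hK₀, measure_vadd, hK]
  have hmap : (volume.restrict (K : Set (EuclideanSpace ℝ (Fin d)))).map (-o + ·) =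
      volume.restrict K₀ := by
    have h := ((measurePreserving_add_left volume (-o)).restrict_image_emb
      (MeasurableEquiv.addLeft (-o)).measurableEmbedding (K : Set (EuclideanSpace ℝ (Fin d)))).map_eq
    rw [h]
    rfl
  have heq : ∀ n, uniformExpectedMissedVolume K n =
      (expectedMiss (volume.restrict K₀) (volume.restrict K₀) n ∅).toReal := fun n => by
    rw [uniformExpectedMissedVolume_eq K hK, ← expectedMiss_map_vadd _ (-o), hmap,
      Set.vadd_set_empty]
  simp only [heq]
  refine ⟨exists_expectedMiss_half_le volume hconv hnhds hcomp hvol, fun κ h0 h1 n => ?_⟩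
  have hprob : IsProbabilityMeasure (volume.restrict K₀) := ⟨by simpa using hvol⟩
  have h := ENNReal.toReal_mono
    (ne_top_of_le_ne_top ENNReal.one_ne_top (expectedMiss_le_one _ _ n ∅))
    (geometric_le_expectedMiss volume hconv hnhds hcomp hvol h0 h1 n)
  rwa [ENNReal.toReal_mul, ENNReal.toReal_pow, ENNReal.toReal_ofReal (by linarith),
    ENNReal.toReal_ofReal h0] at h

end Link

/-! ### The effect of deleting a point -/

section Deletion

variable {d : ℕ}

lemma isClosed_polytope_apply (n : ℕ) (x : ℕ → EuclideanSpace ℝ (Fin d)) :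
    IsClosed (polytope n x) := by
  have : IsClosed ((fun y => (x, y)) ⁻¹' {p : (ℕ → EuclideanSpace ℝ (Fin d)) ×
      EuclideanSpace ℝ (Fin d) | p.2 ∈ polytope n p.1}) :=
    (isClosed_polytope n).preimage (by fun_prop)
  exact this

/-- By Carathéodory's theorem, a point of the hull of `N` points is lost for at most `d + 1` of the
points if a single point is deleted. Deletion of the point with index `i` is expressed by the
transposition of `i` with the last index. -/
lemma exists_card_le_forall_mem_polytope (N : ℕ) (x : ℕ → EuclideanSpace ℝ (Fin d))
    {y : EuclideanSpace ℝ (Fin d)} (hy : y ∈ polytope N x) :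
    ∃ T : Finset ℕ, T.card ≤ d + 1 ∧
      ∀ i < N, i ∉ T → y ∈ polytope (N - 1) (x ∘ Equiv.swap i (N - 1)) := by
  classical
  rw [polytope, convexHull_eq_union] at hy
  simp only [Set.mem_iUnion] at hy
  obtain ⟨t, hts, hind, hyt⟩ := hy
  have hcard : t.card ≤ d + 1 := by
    have h := hind.card_le_finrank_succ
    have h2 := Submodule.finrank_le (vectorSpan ℝ (Set.range ((↑) : t → EuclideanSpace ℝ (Fin d))))
    rw [finrank_euclideanSpace_fin] at h2
    rw [Fintype.card_coe] at h
    omega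
  have hpre : ∀ p ∈ t, ∃ j < N, x j = p := fun p hp => by
    obtain ⟨j, hj, rfl⟩ := hts hp
    exact ⟨j, hj, rfl⟩
  choose! J hJ hxJ using hpre
  refine ⟨t.image J, Finset.card_image_le.trans hcard, fun i hi hiT => ?_⟩
  refine convexHull_mono (fun p hp => ?_) hyt
  have hne : J p ≠ i := fun h => hiT (h ▸ Finset.mem_image_of_mem J hp)
  have hlt := hJ p hp
  by_cases hlast : J p = N - 1
  · refine ⟨i, ?_, ?_⟩
    · rw [Set.mem_Iio]; omega
    · rw [Function.comp, Equiv.swap_apply_left, ← hlast, hxJ p hp]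
  · refine ⟨J p, ?_, ?_⟩
    · rw [Set.mem_Iio]; omega
    · rw [Function.comp, Equiv.swap_apply_of_ne_of_ne hne hlast, hxJ p hp]

lemma polytope_subset_polytope_swap {k i N : ℕ} (hk : k ≤ i) (hi : i < N)
    (x : ℕ → EuclideanSpace ℝ (Fin d)) :
    polytope k x ⊆ polytope (N - 1) (x ∘ Equiv.swap i (N - 1)) := by
  refine convexHull_mono ?_
  rintro _ ⟨j, hj, rfl⟩
  rw [Set.mem_Iio] at hj
  refine ⟨j, ?_, ?_⟩
  · rw [Set.mem_Iio]; omega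
  · rw [Function.comp, Equiv.swap_apply_of_ne_of_ne (by omega) (by omega)]

/-- The regions lost by deleting one of the points with index in `[k, N)` cover each point at most
`d + 1` times and are disjoint from the hull of the first `k` points. -/
lemma sum_volume_lost_le (K : ConvexBody (EuclideanSpace ℝ (Fin d))) (k N : ℕ)
    (x : ℕ → EuclideanSpace ℝ (Fin d)) :
    ∑ i ∈ Finset.Ico k N, volume ((K : Set (EuclideanSpace ℝ (Fin d))) ∩
        (polytope N x \ polytope (N - 1) (x ∘ Equiv.swap i (N - 1)))) ≤
      (d + 1) * volume ((K : Set (EuclideanSpace ℝ (Fin d))) \ polytope k x) := by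
  classical
  have hKm : MeasurableSet (K : Set (EuclideanSpace ℝ (Fin d))) := K.isClosed.measurableSet
  have hm : ∀ n y, MeasurableSet (polytope (d := d) n y) := fun n y =>
    (isClosed_polytope_apply n y).measurableSet
  set D : ℕ → Set (EuclideanSpace ℝ (Fin d)) := fun i => (K : Set (EuclideanSpace ℝ (Fin d))) ∩
    (polytope N x \ polytope (N - 1) (x ∘ Equiv.swap i (N - 1))) with hD
  have hDm : ∀ i, MeasurableSet (D i) := fun i => hKm.inter ((hm _ _).diff (hm _ _))
  calc ∑ i ∈ Finset.Ico k N, volume (D i)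
      = ∫⁻ y, ∑ i ∈ Finset.Ico k N, (D i).indicator 1 y := by
        rw [lintegral_finsetSum _ fun i _ => measurable_one.indicator (hDm i)]
        exact Finset.sum_congr rfl fun i _ => (lintegral_indicator_one (hDm i)).symm
    _ ≤ ∫⁻ y, ((K : Set (EuclideanSpace ℝ (Fin d))) \ polytope k x).indicator
          (fun _ => (d + 1 : ℝ≥0∞)) y := by
        refine lintegral_mono fun y => ?_
        have hsum : ∑ i ∈ Finset.Ico k N, (D i).indicator 1 y =
            (((Finset.Ico k N).filter fun i => y ∈ D i).card : ℝ≥0∞) := by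
          rw [Finset.card_filter, Nat.cast_sum]
          refine Finset.sum_congr rfl fun i _ => ?_
          by_cases h : y ∈ D i <;> simp [h]
        simp only
        rw [hsum]
        by_cases hne : ((Finset.Ico k N).filter fun i => y ∈ D i).Nonempty
        · obtain ⟨i, hi⟩ := hne
          obtain ⟨hi, hyK, hyN, hyi⟩ := Finset.mem_filter.1 hi
          obtain ⟨hki, hiN⟩ := Finset.mem_Ico.1 hi
          rw [Set.indicator_of_mem (show y ∈ (K : Set (EuclideanSpace ℝ (Fin d))) \ polytope k x from
            ⟨hyK, fun h => hyi (polytope_subset_polytope_swap hki hiN x h)⟩)]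
          obtain ⟨T, hT, hTy⟩ := exists_card_le_forall_mem_polytope N x hyN
          have hsub : ((Finset.Ico k N).filter fun i => y ∈ D i) ⊆ T := fun j hj => by
            obtain ⟨hj, -, -, hyj⟩ := Finset.mem_filter.1 hj
            by_contra hjT
            exact hyj (hTy j (Finset.mem_Ico.1 hj).2 hjT)
          exact_mod_cast (Finset.card_le_card hsub).trans hT
        · rw [Finset.not_nonempty_iff_eq_empty.1 hne]
          simp
    _ = _ := by rw [lintegral_indicator_const (hKm.diff (hm _ _))]

lemma integral_missedVolume_swap (K : ConvexBody (EuclideanSpace ℝ (Fin d)))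
    (hK : volume (K : Set (EuclideanSpace ℝ (Fin d))) = 1) (n : ℕ) (e : Equiv.Perm ℕ) :
    Integrable (fun x => missedVolume K n (x ∘ e)) (pointsLaw K) ∧
      ∫ x, missedVolume K n (x ∘ e) ∂(pointsLaw K) = uniformExpectedMissedVolume K n := by
  have := isProbabilityMeasure_uniformLaw K hK
  have hm : Measurable fun x : ℕ → EuclideanSpace ℝ (Fin d) => x ∘ e :=
    measurable_pi_lambda _ fun i => measurable_pi_apply (e i)
  have hmap : (pointsLaw K).map (fun x => x ∘ e) = pointsLaw K :=
    map_comp_equiv_infinitePi (uniformLaw K) e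
  constructor
  · have h := integrable_missedVolume K hK n
    rw [← hmap] at h
    exact h.comp_measurable hm
  · have h := integral_map (μ := pointsLaw K) hm.aemeasurable
      (f := missedVolume K n) (measurable_missedVolume K n).aestronglyMeasurable
    rw [hmap] at h
    exact h.symm

/-- The gain from the last of `k + m` points is at most `(d + 1) / m` times the expected volume
missed by `k` points. If `k + m = 0`, where `k + m - 1` is
truncated, the left-hand side vanishes. -/
theorem mul_sub_uniformExpectedMissedVolume_le (K : ConvexBody (EuclideanSpace ℝ (Fin d)))
    (hK : volume (K : Set (EuclideanSpace ℝ (Fin d))) = 1) (k m : ℕ) :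
    m * (uniformExpectedMissedVolume K (k + m - 1) - uniformExpectedMissedVolume K (k + m)) ≤
      (d + 1) * uniformExpectedMissedVolume K k := by
  set N := k + m with hN
  have hfin : ∀ A : Set (EuclideanSpace ℝ (Fin d)),
      volume ((K : Set (EuclideanSpace ℝ (Fin d))) ∩ A) ≠ ∞ := fun A =>
    ne_top_of_le_ne_top (by simp [hK]) (measure_mono Set.inter_subset_left)
  have hpath : ∀ x, ∑ i ∈ Finset.Ico k N, (missedVolume K (N - 1) (x ∘ Equiv.swap i (N - 1)) -
      missedVolume K N x) ≤ (d + 1) * missedVolume K k x := by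
    intro x
    have h1 := ENNReal.toReal_mono (ENNReal.mul_ne_top (by simp) (by
      rw [Set.sdiff_eq]; exact hfin _)) (sum_volume_lost_le K k N x)
    rw [ENNReal.toReal_sum fun i _ => hfin _, ENNReal.toReal_mul] at h1
    have h2 : ((d : ℝ≥0∞) + 1).toReal = d + 1 := by
      rw [ENNReal.toReal_add (by simp) (by simp)]; simp
    rw [h2] at h1
    refine le_trans (Finset.sum_le_sum fun i _ => ?_) h1
    rw [sub_le_iff_le_add', missedVolume, missedVolume]
    refine le_trans (measureReal_mono ?_ ?_) (measureReal_union_le _ _)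
    · rintro y ⟨hyK, hy⟩
      by_cases hyN : y ∈ polytope N x
      · exact Or.inr ⟨hyK, hyN, hy⟩
      · exact Or.inl ⟨hyK, hyN⟩
    · refine measure_union_ne_top ?_ (hfin _)
      rw [Set.sdiff_eq]; exact hfin _
  have hint : ∀ i, Integrable (fun x => missedVolume K (N - 1) (x ∘ Equiv.swap i (N - 1)) -
      missedVolume K N x) (pointsLaw K) := fun i =>
    (integral_missedVolume_swap K hK _ _).1.sub (integrable_missedVolume K hK N)
  have h := integral_mono (integrable_finsetSum (Finset.Ico k N) fun i _ => hint i)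
    ((integrable_missedVolume K hK k).const_mul ((d : ℝ) + 1)) hpath
  rw [integral_finsetSum _ fun i _ => hint i, integral_const_mul] at h
  have hi : ∀ i ∈ Finset.Ico k N, ∫ x, (missedVolume K (N - 1) (x ∘ Equiv.swap i (N - 1)) -
      missedVolume K N x) ∂(pointsLaw K) =
      uniformExpectedMissedVolume K (N - 1) - uniformExpectedMissedVolume K N := fun i _ => by
    rw [integral_sub (integral_missedVolume_swap K hK _ _).1 (integrable_missedVolume K hK N),
      (integral_missedVolume_swap K hK _ _).2]
    rfl
  rw [Finset.sum_congr rfl hi, Finset.sum_const, Nat.card_Ico, nsmul_eq_mul, hN,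
    Nat.add_sub_cancel_left] at h
  exact h

lemma antitone_uniformExpectedMissedVolume (K : ConvexBody (EuclideanSpace ℝ (Fin d)))
    (hK : volume (K : Set (EuclideanSpace ℝ (Fin d))) = 1) :
    Antitone (uniformExpectedMissedVolume K) := fun k n hkn => by
  refine integral_mono (integrable_missedVolume K hK n) (integrable_missedVolume K hK k) fun x => ?_
  refine measureReal_mono (Set.sdiff_subset_sdiff_right (convexHull_mono (Set.image_mono
    (Set.Iio_subset_Iio hkn)))) ?_
  exact ne_top_of_le_ne_top (by simp [hK]) (measure_mono Set.sdiff_subset)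

lemma uniformExpectedMissedVolume_mem_Icc (K : ConvexBody (EuclideanSpace ℝ (Fin d)))
    (hK : volume (K : Set (EuclideanSpace ℝ (Fin d))) = 1) (n : ℕ) :
    uniformExpectedMissedVolume K n ∈ Set.Icc (0 : ℝ) 1 := by
  have := isProbabilityMeasure_pointsLaw K hK
  refine ⟨integral_nonneg fun x => (missedVolume_mem_Icc K hK n x).1, ?_⟩
  have h := integral_mono (integrable_missedVolume K hK n) (integrable_const (1 : ℝ))
    fun x => (missedVolume_mem_Icc K hK n x).2
  simpa [uniformExpectedMissedVolume] using h

end Deletion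

/-! ### Poisson expectations -/

lemma integrable_and_integral_poissonMeasure {r : NNReal} {f : ℕ → ℝ} (hf : ∀ k, 0 ≤ f k) {s : ℝ}
    (h : HasSum (fun k : ℕ => Real.exp (-r) * (r : ℝ) ^ k / (k.factorial : ℝ) * f k) s) :
    Integrable f (poissonMeasure r) ∧ ∫ k, f k ∂(poissonMeasure r) = s := by
  constructor
  · rw [integrable_poissonMeasure_iff]
    simpa only [Real.norm_of_nonneg (hf _)] using h.summable
  · rw [integral_poissonMeasure]
    exact h.tsum_eq

/-- The variance of the Poisson law. -/
lemma integral_sub_sq_poissonMeasure (r : NNReal) :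
    Integrable (fun k : ℕ => ((k : ℝ) - r) ^ 2) (poissonMeasure r) ∧
      ∫ k : ℕ, ((k : ℝ) - r) ^ 2 ∂(poissonMeasure r) = r := by
  refine integrable_and_integral_poissonMeasure (fun k => sq_nonneg _) ?_
  set p : ℕ → ℝ := fun k => Real.exp (-r) * (r : ℝ) ^ k / (k.factorial : ℝ) with hp
  have h0 : HasSum p 1 := hasSum_one_poissonMeasure r
  have hstep : ∀ k : ℕ, p (k + 1) * ((k : ℝ) + 1) = r * p k := fun k => by
    simp only [hp, Nat.factorial_succ, pow_succ]
    push_cast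
    have : (k.factorial : ℝ) ≠ 0 := by positivity
    have : (k : ℝ) + 1 ≠ 0 := by positivity
    field_simp
  have h1 : HasSum (fun k : ℕ => p k * k) r := by
    rw [← hasSum_nat_add_iff' 1]
    simpa [hstep] using h0.mul_left (r : ℝ)
  have h2 : HasSum (fun k : ℕ => p k * (k * (k - 1))) ((r : ℝ) * r) := by
    rw [← hasSum_nat_add_iff' 1]
    have : ∀ k : ℕ, p (k + 1) * (((k + 1 : ℕ) : ℝ) * (((k + 1 : ℕ) : ℝ) - 1)) =
        r * (p k * k) := fun k => by
      push_cast
      linear_combination (k : ℝ) * hstep k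
    simp only [this]
    simpa using h1.mul_left (r : ℝ)
  convert (h2.add (h1.mul_right (1 - 2 * (r : ℝ)))).add (h0.mul_right ((r : ℝ) ^ 2)) using 1
  · funext k
    simp only [hp]
    ring
  · ring

lemma integral_half_pow_poissonMeasure (r : NNReal) :
    Integrable (fun k : ℕ => (1 / 2 : ℝ) ^ k) (poissonMeasure r) ∧
      ∫ k : ℕ, (1 / 2 : ℝ) ^ k ∂(poissonMeasure r) = Real.exp (-(r / 2)) := by
  refine integrable_and_integral_poissonMeasure (fun k => by positivity) ?_
  have h : HasSum (fun k : ℕ => ((r : ℝ) / 2) ^ k / (k.factorial : ℝ)) (Real.exp (r / 2)) := by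
    rw [Real.exp_eq_exp_ℝ]
    exact NormedSpace.expSeries_div_hasSum_exp ((r : ℝ) / 2)
  convert! h.mul_left (Real.exp (-r)) using 1
  · funext k
    rw [div_pow, div_pow, one_pow]
    field_simp
  · rw [← Real.exp_add]
    congr 1
    ring

/-! ### De-Poissonization -/

/-- Doubling and the bound on the decrements make `e` Lipschitz with relative constant `D / n`
on the indices `k ≥ n / 2`. -/
lemma exists_abs_sub_le_of_doubling {e : ℕ → ℝ} (he : Antitone e) (he0 : ∀ n, 0 ≤ e n) {A B : ℝ}
    (hB : 0 ≤ B) (hA : ∀ n, e (n / 2) ≤ A * e n)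
    (hdec : ∀ k m : ℕ, m * (e (k + m - 1) - e (k + m)) ≤ B * e k) :
    ∃ D, 0 ≤ D ∧ ∀ n k : ℕ, n ≤ 2 * k → n * |e k - e n| ≤ D * |(k : ℝ) - n| * e n := by
  refine ⟨4 * B * |A| ^ 2, by positivity, fun n k hk => ?_⟩
  set D := 4 * B * |A| ^ 2 with hD
  have hA' : ∀ n, e (n / 2) ≤ |A| * e n := fun n =>
    (hA n).trans (mul_le_mul_of_nonneg_right (le_abs_self A) (he0 n))
  have hquarter : e (n / 2 / 2) ≤ |A| ^ 2 * e n := by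
    calc e (n / 2 / 2) ≤ |A| * e (n / 2) := hA' _
      _ ≤ |A| * (|A| * e n) := by gcongr; exact hA' n
      _ = |A| ^ 2 * e n := by ring
  have hstep : ∀ j : ℕ, n ≤ 2 * j → n * (e j - e (j + 1)) ≤ D * e n := by
    intro j hj
    -- of the first `j + 1` points, about one half are kept
    have h := hdec ((j + 1) / 2) (j + 1 - (j + 1) / 2)
    rw [show (j + 1) / 2 + (j + 1 - (j + 1) / 2) = j + 1 by omega, Nat.add_sub_cancel] at h
    have h1 : e ((j + 1) / 2) ≤ |A| ^ 2 * e n := (he (by omega)).trans hquarter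
    have h2 : (n : ℝ) ≤ 4 * ((j + 1 - (j + 1) / 2 : ℕ) : ℝ) := by
      have : n ≤ 4 * (j + 1 - (j + 1) / 2) := by omega
      exact_mod_cast this
    have h3 : 0 ≤ e j - e (j + 1) := sub_nonneg.2 (he (Nat.le_succ j))
    calc n * (e j - e (j + 1)) ≤ 4 * ((j + 1 - (j + 1) / 2 : ℕ) : ℝ) * (e j - e (j + 1)) := by
          gcongr
      _ ≤ 4 * (B * e ((j + 1) / 2)) := by linarith
      _ ≤ 4 * (B * (|A| ^ 2 * e n)) := by gcongr
      _ = D * e n := by rw [hD]; ring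
  have hchain : ∀ a b : ℕ, n ≤ 2 * a → a ≤ b → n * (e a - e b) ≤ D * ((b : ℝ) - a) * e n := by
    intro a b ha hab
    induction b, hab using Nat.le_induction with
    | base => simp
    | succ b hab ih =>
      have := hstep b (by omega)
      push_cast
      linarith
  rcases le_total k n with h | h
  · have hc : (k : ℝ) ≤ n := by exact_mod_cast h
    rw [abs_of_nonneg (sub_nonneg.2 (he h)), abs_of_nonpos (sub_nonpos.2 hc), neg_sub]
    exact hchain k n hk h
  · have hc : (n : ℝ) ≤ k := by exact_mod_cast h
    rw [abs_of_nonpos (sub_nonpos.2 (he h)), abs_of_nonneg (sub_nonneg.2 hc), neg_sub]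
    exact hchain n k (by omega) h

/-- Pointwise form of the comparison of `e k` with `e n`: the deviation of `k` from `n` is replaced
by its square by means of the inequality of arithmetic and geometric means, and the indices
`k < n / 2` are taken care of by an exponential term. -/
lemma abs_sub_le_of_lipschitz {e : ℕ → ℝ} (he : ∀ k, e k ∈ Set.Icc (0 : ℝ) 1) {D : ℝ}
    (hD : 0 ≤ D) {n : ℕ} (hn : 0 < n) (k : ℕ)
    (hlip : n ≤ 2 * k → n * |e k - e n| ≤ D * |(k : ℝ) - n| * e n) :
    |e k - e n| ≤ D / (2 * √n) * e n + D / (2 * (n * √n)) * e n *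
      ((k : ℝ) - n) ^ 2 + √2 ^ n * (1 / 2 : ℝ) ^ k := by
  have hn' : (0 : ℝ) < n := by exact_mod_cast hn
  have hs : 0 < √(n : ℝ) := Real.sqrt_pos.2 hn'
  have hen := (he n).1
  rcases le_or_gt n (2 * k) with hk | hk
  · have h1 := hlip hk
    have h6 : 0 ≤ √2 ^ n * (1 / 2 : ℝ) ^ k := by positivity
    refine le_trans ?_ (le_add_of_nonneg_right h6)
    have hss : √(n : ℝ) ^ 2 = n := Real.sq_sqrt hn'.le
    have hw := sq_abs ((k : ℝ) - n)
    generalize |(k : ℝ) - n| = w at h1 hw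
    generalize |e k - e n| = z at h1 ⊢
    generalize e n = a at h1 hen ⊢
    generalize √(n : ℝ) = s at hs hss ⊢
    rw [← hw, ← hss]
    rw [← hss] at h1
    have ham : 2 * s * w ≤ s ^ 2 + w ^ 2 := two_mul_le_add_sq s w
    have h3 : z ≤ D * w * a / s ^ 2 := by
      rw [le_div_iff₀ (by positivity)]; linarith
    have h4 : D * w * a / s ^ 2 = D * a / (2 * s ^ 3) * (2 * s * w) := by
      field_simp
    have h5 : D / (2 * s) * a + D / (2 * (s ^ 2 * s)) * a * w ^ 2 =
        D * a / (2 * s ^ 3) * (s ^ 2 + w ^ 2) := by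
      field_simp
    rw [h5]
    refine h3.trans (h4.trans_le ?_)
    exact mul_le_mul_of_nonneg_left ham (by positivity)
  · have h1 : |e k - e n| ≤ 1 := by
      rw [abs_le]
      constructor <;> linarith [(he k).1, (he k).2, (he n).1, (he n).2]
    have h2 : (1 : ℝ) ≤ √2 ^ n * (1 / 2 : ℝ) ^ k := by
      have h3 : (2 : ℝ) ^ k ≤ √2 ^ n := by
        calc (2 : ℝ) ^ k = √2 ^ (2 * k) := by rw [pow_mul, Real.sq_sqrt (by norm_num)]
          _ ≤ √2 ^ n := pow_le_pow_right₀ (Real.one_le_sqrt.2 (by norm_num)) hk.le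
      rw [one_div, inv_pow, ← div_eq_mul_inv, one_le_div (by positivity)]
      exact h3
    have h6 : 0 ≤ D / (2 * √n) * e n + D / (2 * (n * √n)) * e n * ((k : ℝ) - n) ^ 2 := by
      positivity
    linarith

/-- The mean absolute deviation of the Poisson law with mean `n` is at most `√n`, and the event
that less than `n / 2` points occur is exponentially unlikely. -/
lemma abs_integral_poissonMeasure_sub_le {e : ℕ → ℝ} (he : ∀ k, e k ∈ Set.Icc (0 : ℝ) 1) {D : ℝ}
    (hD : 0 ≤ D) {n : ℕ} (hn : 0 < n)
    (hlip : ∀ k : ℕ, n ≤ 2 * k → n * |e k - e n| ≤ D * |(k : ℝ) - n| * e n) :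
    |∫ k, e k ∂(poissonMeasure (n : NNReal)) - e n| ≤
      D / √n * e n + (√2 * Real.exp (-(1 / 2))) ^ n := by
  have hn' : (0 : ℝ) < n := by exact_mod_cast hn
  obtain ⟨i1, v1⟩ := integral_sub_sq_poissonMeasure (n : NNReal)
  obtain ⟨i2, v2⟩ := integral_half_pow_poissonMeasure (n : NNReal)
  simp only [NNReal.coe_natCast] at i1 v1 i2 v2
  have hpt := fun k => abs_sub_le_of_lipschitz he hD hn k (hlip k)
  have hprob : IsProbabilityMeasure (poissonMeasure (n : NNReal)) := inferInstance
  generalize poissonMeasure (n : NNReal) = P at i1 v1 i2 v2 hprob ⊢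
  have hie : Integrable e P :=
    Integrable.of_mem_Icc 0 1 (measurable_of_countable e).aemeasurable (ae_of_all _ he)
  have hsub : ∫ k, e k ∂P - e n =
      ∫ k, (e k - e n) ∂P := by
    rw [integral_sub hie (integrable_const _)]
    simp
  rw [hsub]
  have j1 : Integrable (fun _ : ℕ => D / (2 * √n) * e n) P :=
    integrable_const _
  have j2 := i1.const_mul (D / (2 * (n * √n)) * e n)
  have j3 := i2.const_mul (√2 ^ n)
  have j12 : Integrable (fun k : ℕ => D / (2 * √n) * e n +
      D / (2 * (n * √n)) * e n * ((k : ℝ) - n) ^ 2) P := j1.add j2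
  have h1 : |∫ k, (e k - e n) ∂P| ≤ ∫ k, |e k - e n| ∂P := abs_integral_le_integral_abs
  have h2 := integral_mono (hie.sub (integrable_const (e n))).abs (j12.add j3) hpt
  have h3 : ∫ k : ℕ, (D / (2 * √n) * e n + D / (2 * (n * √n)) * e n * ((k : ℝ) - n) ^ 2 +
      √2 ^ n * (1 / 2 : ℝ) ^ k) ∂P = D / (2 * √n) * e n + D / (2 * (n * √n)) * e n * n +
      √2 ^ n * Real.exp (-(n / 2)) := by
    rw [integral_add j12 j3, integral_add j1 j2, integral_const_mul (√2 ^ n),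
      integral_const_mul (D / (2 * (n * √n)) * e n), v1, v2]
    simp
  have h4 : D / (2 * √n) * e n + D / (2 * (n * √n)) * e n * n = D / √n * e n := by
    field_simp
    ring
  have h5 : √2 ^ n * Real.exp (-((n : ℝ) / 2)) = (√2 * Real.exp (-(1 / 2))) ^ n := by
    rw [mul_pow, ← Real.exp_nat_mul]
    congr 2
    ring
  rw [h4, h5] at h3
  exact h1.trans (h2.trans_eq h3)

/-- Abstract de-Poissonization with a relative error of order `n ^ (-1 / 2)`. -/
theorem exists_abs_integral_poissonMeasure_sub_le {e : ℕ → ℝ} (he : Antitone e)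
    (he01 : ∀ k, e k ∈ Set.Icc (0 : ℝ) 1) {A B : ℝ} (hB : 0 ≤ B)
    (hA : ∀ n, e (n / 2) ≤ A * e n)
    (hdec : ∀ k m : ℕ, m * (e (k + m - 1) - e (k + m)) ≤ B * e k)
    (hgeom : ∀ κ : ℝ, 0 ≤ κ → κ ≤ 1 → ∀ n, (1 - κ) * κ ^ n ≤ e n) :
    ∃ M, ∀ n : ℕ, 0 < n →
      |∫ k, e k ∂(poissonMeasure (n : NNReal)) - e n| ≤ M / √n * e n := by
  obtain ⟨D, hD, hlip⟩ := exists_abs_sub_le_of_doubling he (fun n => (he01 n).1) hB hA hdec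
  -- `√2 / √e < 1` is the rate of the event that less than half of the points occur
  set θ := √2 * Real.exp (-(1 / 2)) with hθ
  have hθ0 : 0 < θ := by positivity
  have hθ1 : θ < 1 := by
    have h1 : θ ^ 2 < 1 := by
      rw [hθ, mul_pow, Real.sq_sqrt (by norm_num), ← Real.exp_nat_mul]
      norm_num
      rw [Real.exp_neg, ← div_eq_mul_inv, div_lt_one (Real.exp_pos 1)]
      linarith [Real.exp_one_gt_d9]
    nlinarith
  obtain ⟨κ, hκθ, hκ1⟩ := exists_between hθ1
  have hκ0 : 0 < κ := hθ0.trans hκθ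
  have hq : θ / κ < 1 := (div_lt_one hκ0).2 hκθ
  obtain ⟨M, hM⟩ := (tendsto_self_mul_const_pow_of_lt_one (by positivity) hq).bddAbove_range
  refine ⟨D + M / (1 - κ), fun n hn => ?_⟩
  have hn' : (1 : ℝ) ≤ n := by exact_mod_cast hn
  have hs : 1 ≤ √(n : ℝ) := Real.one_le_sqrt.2 hn'
  have hsn : √(n : ℝ) ≤ n := Real.sqrt_le_iff.2 ⟨by linarith, by nlinarith⟩
  have h1κ : 0 < 1 - κ := by linarith
  have hMn : (n : ℝ) * (θ / κ) ^ n ≤ M := hM ⟨n, rfl⟩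
  have htail : θ ^ n ≤ M / (1 - κ) / √n * e n := by
    have h1 := hgeom κ hκ0.le hκ1.le n
    have h2 : √(n : ℝ) * (θ / κ) ^ n ≤ M := le_trans (by gcongr) hMn
    have hM0 : 0 ≤ M := le_trans (by positivity) hMn
    calc θ ^ n = (√(n : ℝ) * (θ / κ) ^ n) * κ ^ n / √n := by
          rw [div_pow]; field_simp
      _ ≤ M * κ ^ n / √n := by gcongr
      _ = M / (1 - κ) / √n * ((1 - κ) * κ ^ n) := by field_simp
      _ ≤ _ := by gcongr
  have := abs_integral_poissonMeasure_sub_le he01 hD hn fun k hk => hlip n k hk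
  have hsplit : (D + M / (1 - κ)) / √n * e n = D / √n * e n + M / (1 - κ) / √n * e n := by ring
  rw [hsplit]
  linarith

/-- The number of points is independent of the points, so the Poisson expectation is a Poisson mean
of the expectations for a fixed number of points. -/
lemma poissonExpectedMissedVolume_eq {d : ℕ} (K : ConvexBody (EuclideanSpace ℝ (Fin d)))
    (hK : volume (K : Set (EuclideanSpace ℝ (Fin d))) = 1) (n : ℕ) :
    poissonExpectedMissedVolume K n =
      ∫ k, uniformExpectedMissedVolume K k ∂(poissonMeasure (n : NNReal)) := by
  have := isProbabilityMeasure_pointsLaw K hK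
  have h := integrable_missedVolume_poisson K hK n
  rw [poissonModelLaw] at h
  rw [poissonExpectedMissedVolume, poissonModelLaw, integral_prod _ h]
  rfl

end RandomPolytope

theorem mainTheorem6 (d : ℕ) (hd : 1 ≤ d) (K : ConvexBody (EuclideanSpace ℝ (Fin d)))
    (hK : volume (K : Set (EuclideanSpace ℝ (Fin d))) = 1) :
    ∃ δ : ℕ → ℝ, Tendsto δ atTop (𝓝 (1 / ((d : ℝ) + 1))) ∧
      ∃ r : ℕ → ℝ, (r =O[atTop] fun n : ℕ => (n : ℝ) ^ (-δ n)) ∧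
        ∀ᶠ n : ℕ in atTop,
          RandomPolytope.poissonExpectedMissedVolume K n =
            RandomPolytope.uniformExpectedMissedVolume K n * (1 + r n) := by
  obtain ⟨⟨A, hA⟩, hgeom⟩ := RandomPolytope.uniformExpectedMissedVolume_bounds hd K hK
  obtain ⟨M, hM⟩ := RandomPolytope.exists_abs_integral_poissonMeasure_sub_le
    (RandomPolytope.antitone_uniformExpectedMissedVolume K hK)
    (RandomPolytope.uniformExpectedMissedVolume_mem_Icc K hK) (B := (d : ℝ) + 1) (by positivity) hA
    (RandomPolytope.mul_sub_uniformExpectedMissedVolume_le K hK) hgeom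
  simp only [← RandomPolytope.poissonExpectedMissedVolume_eq K hK] at hM
  set e := RandomPolytope.uniformExpectedMissedVolume K
  set V := RandomPolytope.poissonExpectedMissedVolume K
  have hpos : ∀ n, 0 < e n := fun n =>
    lt_of_lt_of_le (by positivity) (hgeom (1 / 2) (by norm_num) (by norm_num) n)
  -- a constant exponent is enough, as the relative error is of order `n ^ (-1 / 2)`
  refine ⟨fun _ => 1 / ((d : ℝ) + 1), tendsto_const_nhds, fun n => (V n - e n) / e n, ?_,
    Eventually.of_forall fun n => ?_⟩
  · refine IsBigO.of_bound |M| ((eventually_gt_atTop 0).mono fun n hn => ?_)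
    have hn1 : (1 : ℝ) ≤ n := by exact_mod_cast hn
    have hd' : (2 : ℝ) ≤ (d : ℝ) + 1 := by
      have : (1 : ℝ) ≤ d := by exact_mod_cast hd
      linarith
    have hrate : 1 / √(n : ℝ) ≤ (n : ℝ) ^ (-(1 / ((d : ℝ) + 1))) := by
      rw [Real.sqrt_eq_rpow, one_div, ← Real.rpow_neg (by linarith)]
      refine Real.rpow_le_rpow_of_exponent_le hn1 (neg_le_neg ?_)
      exact one_div_le_one_div_of_le (by norm_num) hd'
    rw [Real.norm_eq_abs, Real.norm_of_nonneg (by positivity), abs_div, abs_of_pos (hpos n),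
      div_le_iff₀ (hpos n)]
    calc |V n - e n| ≤ M / √n * e n := hM n hn
      _ ≤ |M| * (1 / √n) * e n := by
        rw [mul_one_div]
        have := (hpos n).le
        gcongr
        exact le_abs_self M
      _ ≤ _ := by
        have := (hpos n).le
        gcongr
  · have := (hpos n).ne'
    field_simp
    ring
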